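/- **Conventions.** $\mathbf{Met}$ is the category of extended metric spaces (metrics valued in $[0,\infty]$) and nonexpansive maps; $\mathbf{CMet}$ is its full subcategory of countable spaces. $Y^X$ is the space of nonexpansive maps $X\to Y$ with the supremum metric. A $\mathbf{Met}$-category is a category with a metric on each hom-set such that $d(gf,g'f')\le d(g,g')+d(f,f')$; a functor is enriched if it is nonexpansive on hom-sets. A power $X^V$ is an object with a nonexpansive family $V\to\mathcal C(X^V,X)$ inducing isometric bijections $\mathcal C(A,X^V)\to\mathcal C(A,X)^V$ for all $A$. A *$\mathbf{Met}$-Lawvere theory* is a $\mathbf{Met}$-category $\mathcal L$ with an enriched identity-on-objects functor $\mathbf{CMet}^{op}\to\mathcal L$ preserving powers by countable spaces. A *model* of $\mathcal L$ is an enriched functor $\mathcal L\to\mathbf{Met}$ preserving powers by countable spaces; $Mod(\mathcal L)$ is the category of models and natural transformations, with forgetful functor $M\mapsto M(x)$ to $\mathbf{Met}$, where $x$ is the image of the one-point space. A *metric signature* $\Omega$ is a set of operation symbols $f$, each with a countable extended metric space $(N,d)$ as arity. *Preterms* over a countably infinite set of variables are generated by $f((t_i)_{i\in N})$. A *context* $\Gamma$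 is a countable list of formal equalities $x=_\varepsilon y$ between variables ($\varepsilon\in\mathbb R_{\ge0}$). A *judgment* is $\Gamma\vdash t\ ok$ or $\Gamma\vdash s=_\varepsilon t$. Given a set $S$ of judgments, $\vdash_S$ is the least set of judgments containing $S$ and closed under the following rules (hypotheses about $d(i,j)$ are imposed only for $d(i,j)<\infty$): - $\Gamma\vdash x\ ok$ for each variable $x$; $\Gamma\vdash x=_\varepsilon y$ if $(x=_\varepsilon y)\in\Gamma$; - from $\Gamma\vdash t\ ok$ infer $\Gamma\vdash t=_0t$; from $\Gamma\vdash t=_\varepsilon t'$ infer $\Gamma\vdash t'=_\varepsilon t$; from $\Gamma\vdash t=_\varepsilon t'$ and $\Gamma\vdash t'=_{\varepsilon'}t''$ infer $\Gamma\vdash t=_{\varepsilon+\varepsilon'}t''$; - from $\Gamma\vdash t=_{\varepsilon'}t'$ with $\varepsilon'<\varepsilon$ infer $\Gamma\vdash t=_\varepsilon t'$; from $\Gamma\vdash t=_{\varepsilon'}t'$ for all $\varepsilon'>\varepsilon$ infer $\Gamma\vdash t=_\varepsilon t'$; - for $f$ of arity $(N,d)$: from $\Gamma\vdash t_i\ ok$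 and $\Gamma\vdash t_i=_{d(i,j)}t_j$ for all $i,j$ infer $\Gamma\vdash f((t_i))\ ok$; from $\Gamma\vdash s_i=_{d(i,j)}s_j$, $\Gamma\vdash t_i=_{d(i,j)}t_j$ and $\Gamma\vdash s_i=_\varepsilon t_i$ for all $i,j$ infer $\Gamma\vdash f((s_i))=_\varepsilon f((t_i))$; - from $\Delta\vdash s=_\varepsilon t$ and $\Gamma\vdash\sigma(x)=_\delta\sigma(y)$ for all $(x=_\delta y)\in\Delta$ infer $\Gamma\vdash s[\sigma]=_\varepsilon t[\sigma]$, for each substitution $\sigma$ of preterms for variables that fixes the variables not occurring in $\Delta$. A *metric equational theory* (MET) over $\Omega$ is a set $\mathbb T$ of judgments such that $(\Gamma\vdash s=_\varepsilon t)\in\mathbb T$ implies $(\Gamma\vdash s\ ok),(\Gamma\vdash t\ ok)\in\mathbb T$, and $\mathbb T$ is exactly $\vdash_{\mathbb T^=}$, where $\mathbb T^=\subseteq\mathbb T$ consists of the equational judgments. A *model* of $\Omega$ is an extended metric space $M$ with a nonexpansive map $M[f]:M^N\to M$ for each $f$ of arity $N$; homomorphisms are nonexpansive maps commuting with the operations.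 Fix a context $\Gamma$. Always $M$ satisfies $\Gamma\vdash x\ ok$, and $M[x](\alpha)=\alpha(x)$ for each assignment $\alpha$ in $M$ satisfying $\Gamma$ (i.e. $d(\alpha(x),\alpha(y))\le\varepsilon$ for all $(x=_\varepsilon y)\in\Gamma$). $M$ satisfies $\Gamma\vdash f((t_i))\ ok$ if it satisfies every $\Gamma\vdash t_i\ ok$ and $d(M[t_i](\alpha),M[t_j](\alpha))\le d(i,j)$ for all $i,j$ and all such $\alpha$; then $M[f((t_i))](\alpha)=M[f]((M[t_i](\alpha))_i)$. $M$ satisfies $\Gamma\vdash s=_\varepsilon t$ if it satisfies $\Gamma\vdash s\ ok$ and $\Gamma\vdash t\ ok$ and $d(M[s](\alpha),M[t](\alpha))\le\varepsilon$ for all such $\alpha$. $Mod(\mathbb T)$ is the full subcategory of the models of $\Omega$ that satisfy every judgment of $\mathbb T$. **Statement.** Let $\mathbb T$ be a metric equational theory. 1. The forgetful functor $Mod(\mathbb T)\to\mathbf{Met}$ has a left adjoint, and the induced free-model monad $Free^{\mathbb T}:\mathbf{Met}\to\mathbf{Met}$ (for any choice of left adjoint) preserves all small countably filtered (i.e. $\aleph_1$-filtered)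 colimits. 2. There is a $\mathbf{Met}$-Lawvere theory $\mathcal L$ with an equivalence of categories $Mod(\mathbb T)\simeq Mod(\mathcal L)$ which commutes, up to natural isomorphism, with the forgetful functors to $\mathbf{Met}$. -/

import Mathlib

open CategoryTheory Opposite
open scoped ENNReal NNReal Cardinal

universe u v w

/-! ### Extended metric spaces and nonexpansive maps -/

/-- A map of extended metric spaces is nonexpansive if it does not increase distances. -/
def Nonexpansive {X : Type u} {Y : Type v} [EMetricSpace X] [EMetricSpace Y] (f : X → Y) : Prop :=
  ∀ x y, edist (f x) (f y) ≤ edist x y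

/-- The set `Y ^ X` of nonexpansive maps from `X` to `Y`. -/
@[ext]
structure NonexpMap (X : Type u) (Y : Type v) [EMetricSpace X] [EMetricSpace Y] where
  toFun : X → Y
  nonexpansive : Nonexpansive toFun

namespace NonexpMap

variable {X : Type u} {Y : Type v} {Z : Type w} [EMetricSpace X] [EMetricSpace Y] [EMetricSpace Z]

instance : CoeFun (NonexpMap X Y) (fun _ => X → Y) := ⟨NonexpMap.toFun⟩

/-- The supremum metric on `Y ^ X`. -/
noncomputable instance : EMetricSpace (NonexpMap X Y) where
  edist f g := ⨆ x, edist (f x) (g x)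
  edist_self f := by simp
  edist_comm f g := by simp only [edist_comm]
  edist_triangle f g h := iSup_le fun x => (edist_triangle _ (g x) _).trans
    (add_le_add (le_iSup (fun x => edist (f x) (g x)) x) (le_iSup (fun x => edist (g x) (h x)) x))
  eq_of_edist_eq_zero {f g} h := by
    ext x
    exact eq_of_edist_eq_zero (le_antisymm ((le_iSup (fun x => edist (f x) (g x)) x).trans h.le)
      (zero_le))

theorem edist_def (f g : NonexpMap X Y) : edist f g = ⨆ x, edist (f x) (g x) := rfl

/-- The identity map. -/
def id (X : Type u) [EMetricSpace X] : NonexpMap X X := ⟨fun x => x, fun _ _ => le_rfl⟩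

/-- `g.comp f` is the composite `x ↦ g (f x)`. -/
def comp (g : NonexpMap Y Z) (f : NonexpMap X Y) : NonexpMap X Z :=
  ⟨fun x => g (f x), fun x y => (g.nonexpansive _ _).trans (f.nonexpansive x y)⟩

end NonexpMap

/-- The objects of the category `Met`: extended metric spaces. -/
structure Met : Type (u + 1) where
  carrier : Type u
  [str : EMetricSpace carrier]

attribute [instance] Met.str

namespace Met

instance : CoeSort Met.{u} (Type u) := ⟨Met.carrier⟩

/-- The category of extended metric spaces and nonexpansive maps. -/
instance : Category.{u} Met.{u} where
  Hom X Y := NonexpMap X Y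
  id X := NonexpMap.id X
  comp f g := NonexpMap.comp g f

end Met

/-! ### Categories enriched in `Met` -/

/-- A `Met`-enrichment of an ordinary category: a metric on each hom-set such that composition
`C(Y, Z) ⊗ C(X, Y) → C(X, Z)` is nonexpansive, where `⊗` carries the sum metric. -/
class MetCategory (C : Type u) [Category.{v} C] where
  homMetric : ∀ X Y : C, EMetricSpace (X ⟶ Y)
  edist_comp_le : ∀ {X Y Z : C} (f f' : X ⟶ Y) (g g' : Y ⟶ Z),
    edist (f ≫ g) (f' ≫ g') ≤ edist f f' + edist g g'

attribute [reducible, instance] MetCategory.homMetric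

/-- `Met` is enriched in itself through the supremum metric. -/
noncomputable instance : MetCategory Met.{u} where
  homMetric X Y := inferInstanceAs (EMetricSpace (NonexpMap X Y))
  edist_comp_le {X Y Z} f f' g g' := iSup_le fun x => by
    refine (edist_triangle (g.toFun (f.toFun x)) (g.toFun (f'.toFun x))
      (g'.toFun (f'.toFun x))).trans (add_le_add ?_ ?_)
    · exact (g.nonexpansive _ _).trans (le_iSup (fun x => edist (f.toFun x) (f'.toFun x)) x)
    · exact le_iSup (fun y => edist (g.toFun y) (g'.toFun y)) (f'.toFun x)

/-- The enrichment inherited by a full subcategory. -/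
instance {C : Type u} [Category.{v} C] [MetCategory C] (P : ObjectProperty C) :
    MetCategory P.FullSubcategory where
  homMetric X Y := EMetricSpace.induced (fun f : X ⟶ Y => f.hom)
    (fun _ _ h => ObjectProperty.hom_ext P h) inferInstance
  edist_comp_le f f' g g' := MetCategory.edist_comp_le f.hom f'.hom g.hom g'.hom

/-- The enrichment of the opposite category. -/
instance {C : Type u} [Category.{v} C] [MetCategory C] : MetCategory Cᵒᵖ where
  homMetric X Y := EMetricSpace.induced (fun f : X ⟶ Y => f.unop)
    Quiver.Hom.unop_inj inferInstance
  edist_comp_le f f' g g' :=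
    (MetCategory.edist_comp_le g.unop g'.unop f.unop f'.unop).trans_eq (add_comm _ _)

section Enriched

variable {C : Type u} [Category.{v} C] [MetCategory C]

/-- A functor between `Met`-categories is enriched if it is nonexpansive on hom-sets. -/
def IsMetFunctor {D : Type*} [Category* D] [MetCategory D] (F : C ⥤ D) : Prop :=
  ∀ X Y : C, Nonexpansive (fun f : X ⟶ Y => F.map f)

/-- The object `P`, with the family of projections `π`, is a power (cotensor) `X ^ V`:
`π` is a nonexpansive map `V → C(P, X)`, and for every object `A` the induced map
`C(A, P) → [V, C(A, X)]`, `g ↦ (v ↦ g ≫ π v)`, is a bijective isometry. -/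
structure IsPower (V : Type w) [EMetricSpace V] {P X : C} (π : V → (P ⟶ X)) : Prop where
  nonexpansive : Nonexpansive π
  lift : ∀ (A : C) (φ : V → (A ⟶ X)), Nonexpansive φ → ∃! g : A ⟶ P, ∀ v, g ≫ π v = φ v
  isometry : ∀ (A : C) (g h : A ⟶ P), edist g h = ⨆ v, edist (g ≫ π v) (h ≫ π v)

/-- The functor `F` preserves powers by countable metric spaces. -/
def PreservesCountablePowers {D : Type*} [Category* D] [MetCategory D] (F : C ⥤ D) : Prop :=
  ∀ (V : Type) [EMetricSpace V] [Countable V] (P X : C) (π : V → (P ⟶ X)),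
    IsPower V π → IsPower V (fun v => F.map (π v))

end Enriched

/-! ### Enriched Lawvere theories -/

/-- The full subcategory of `Met` on the countable extended metric spaces. -/
abbrev CMet : Type (u + 1) :=
  ObjectProperty.FullSubcategory (fun X : Met.{u} => Countable X)

/-- The one-point metric space. -/
noncomputable def CMet.point : CMet.{u} := ⟨⟨PUnit.{u + 1}⟩, inferInstance⟩

/-- A `Met`-Lawvere theory: a `Met`-category with an enriched functor from the opposite of `CMet`
that preserves powers by countable spaces and identifies the objects of the two categories. -/
structure MetLawvereTheory : Type (u + 2) where
  Obj : Type (u + 1)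
  [category : Category.{u} Obj]
  [enrichment : MetCategory Obj]
  functor : CMet.{u}ᵒᵖ ⥤ Obj
  bijective_obj : Function.Bijective functor.obj
  enriched : IsMetFunctor functor
  preservesPowers : PreservesCountablePowers functor

namespace MetLawvereTheory

attribute [instance] category enrichment

variable (L : MetLawvereTheory.{u})

/-- The distinguished object `x`, the image of the one-point space. -/
noncomputable def generator : L.Obj := L.functor.obj (op CMet.point)

/-- The category of models: the enriched functors to `Met` that preserve countable powers, and
their natural transformations. -/
abbrev Mod : Type (u + 1) :=
  ObjectProperty.FullSubcategory
    (fun M : L.Obj ⥤ Met.{u} => IsMetFunctor M ∧ PreservesCountablePowers M)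

/-- The forgetful functor `M ↦ M(x)`. -/
noncomputable def forget : L.Mod ⥤ Met.{u} :=
  ObjectProperty.ι _ ⋙ (evaluation L.Obj Met.{u}).obj L.generator

end MetLawvereTheory

/-! ### Metric signatures, preterms, judgments -/

/-- A metric signature: operation symbols with countable metric spaces as arities. -/
structure MetricSignature : Type (u + 1) where
  Op : Type u
  arity : Op → Type
  [metric : ∀ f, EMetricSpace (arity f)]
  [countable : ∀ f, Countable (arity f)]

attribute [instance] MetricSignature.metric MetricSignature.countable

/-- Preterms over a set `X` of variables. -/
inductive Preterm (Ω : MetricSignature.{u}) (X : Type v) : Type (max u v)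
  | var (x : X) : Preterm Ω X
  | app (f : Ω.Op) (t : Ω.arity f → Preterm Ω X) : Preterm Ω X

/-- Simultaneous substitution. -/
def Preterm.subst {Ω : MetricSignature.{u}} {X : Type v} {Y : Type w} (σ : X → Preterm Ω Y) :
    Preterm Ω X → Preterm Ω Y
  | .var x => σ x
  | .app f t => .app f (fun i => (t i).subst σ)

/-- A quantitative equality `lhs =_bound rhs` between variables. -/
structure VarEq (X : Type v) where
  lhs : X
  rhs : X
  bound : ℝ≥0

/-- A context: a (finite or infinite) list of quantitative equalities between variables, of which
only the countable set of its members matters. -/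
structure MetContext (X : Type v) where
  eqs : Set (VarEq X)
  countable : eqs.Countable

namespace MetContext

variable {X : Type v}

/-- The variables that occur in a context. -/
def vars (Γ : MetContext X) : Set X := {x | ∃ e ∈ Γ.eqs, e.lhs = x ∨ e.rhs = x}

/-- The assignment `α` satisfies all equalities of the context `Γ`. -/
def Satisfies {M : Type u} [EMetricSpace M] (Γ : MetContext X) (α : X → M) : Prop :=
  ∀ e ∈ Γ.eqs, edist (α e.lhs) (α e.rhs) ≤ e.bound

/-- The assignments in `M` that satisfy `Γ`. -/
def Assign (Γ : MetContext X) (M : Type u) [EMetricSpace M] : Type (max u v) :=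
  {α : X → M // Γ.Satisfies α}

end MetContext

/-- Judgments `Γ ⊢ t ok` and `Γ ⊢ s =_ε t`, over the countably infinite set `ℕ` of variables. -/
inductive MetJudgment (Ω : MetricSignature.{u}) : Type u
  | ok (Γ : MetContext ℕ) (t : Preterm Ω ℕ) : MetJudgment Ω
  | eq (Γ : MetContext ℕ) (s t : Preterm Ω ℕ) (ε : ℝ≥0) : MetJudgment Ω

open MetJudgment in
/-- The least deducibility relation `⊢_S` that contains the set `S` of judgments. -/
inductive MetDerives {Ω : MetricSignature.{u}} (S : Set (MetJudgment Ω)) : MetJudgment Ω → Prop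
  | ax {j : MetJudgment Ω} : j ∈ S → MetDerives S j
  | var (Γ : MetContext ℕ) (x : ℕ) : MetDerives S (ok Γ (.var x))
  | assum (Γ : MetContext ℕ) (e : VarEq ℕ) :
      e ∈ Γ.eqs → MetDerives S (eq Γ (.var e.lhs) (.var e.rhs) e.bound)
  | refl {Γ : MetContext ℕ} {t : Preterm Ω ℕ} :
      MetDerives S (ok Γ t) → MetDerives S (eq Γ t t 0)
  | symm {Γ : MetContext ℕ} {t t' : Preterm Ω ℕ} {ε : ℝ≥0} :
      MetDerives S (eq Γ t t' ε) → MetDerives S (eq Γ t' t ε)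
  | triang {Γ : MetContext ℕ} {t t' t'' : Preterm Ω ℕ} {ε ε' : ℝ≥0} :
      MetDerives S (eq Γ t t' ε) → MetDerives S (eq Γ t' t'' ε') →
      MetDerives S (eq Γ t t'' (ε + ε'))
  | max {Γ : MetContext ℕ} {t t' : Preterm Ω ℕ} {ε ε' : ℝ≥0} :
      ε' < ε → MetDerives S (eq Γ t t' ε') → MetDerives S (eq Γ t t' ε)
  | cont {Γ : MetContext ℕ} {t t' : Preterm Ω ℕ} {ε : ℝ≥0} :
      (∀ ε', ε < ε' → MetDerives S (eq Γ t t' ε')) → MetDerives S (eq Γ t t' ε)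
  | nexp {Γ : MetContext ℕ} (f : Ω.Op) {s t : Ω.arity f → Preterm Ω ℕ} {ε : ℝ≥0} :
      (∀ (i j : Ω.arity f) (δ : ℝ≥0), edist i j = δ → MetDerives S (eq Γ (s i) (s j) δ)) →
      (∀ (i j : Ω.arity f) (δ : ℝ≥0), edist i j = δ → MetDerives S (eq Γ (t i) (t j) δ)) →
      (∀ i, MetDerives S (eq Γ (s i) (t i) ε)) →
      MetDerives S (eq Γ (.app f s) (.app f t) ε)
  | subst {Γ Δ : MetContext ℕ} (σ : ℕ → Preterm Ω ℕ) {s t : Preterm Ω ℕ} {ε : ℝ≥0} :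
      (∀ x, x ∉ Δ.vars → σ x = .var x) →
      (∀ e ∈ Δ.eqs, MetDerives S (eq Γ (σ e.lhs) (σ e.rhs) e.bound)) →
      MetDerives S (eq Δ s t ε) → MetDerives S (eq Γ (s.subst σ) (t.subst σ) ε)
  | app {Γ : MetContext ℕ} (f : Ω.Op) {t : Ω.arity f → Preterm Ω ℕ} :
      (∀ i, MetDerives S (ok Γ (t i))) →
      (∀ (i j : Ω.arity f) (δ : ℝ≥0), edist i j = δ → MetDerives S (eq Γ (t i) (t j) δ)) →
      MetDerives S (ok Γ (.app f t))

/-- The equational judgments in a set of judgments. -/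
def equationalPart {Ω : MetricSignature.{u}} (S : Set (MetJudgment Ω)) : Set (MetJudgment Ω) :=
  {j | j ∈ S ∧ ∃ Γ s t ε, j = MetJudgment.eq Γ s t ε}

/-- A metric equational theory: a well-formed collection of judgments that is the deducibility
relation generated by its equational judgments. -/
structure MetricEquationalTheory (Ω : MetricSignature.{u}) where
  judgments : Set (MetJudgment Ω)
  wellFormed : ∀ Γ s t ε, MetJudgment.eq Γ s t ε ∈ judgments →
    MetJudgment.ok Γ s ∈ judgments ∧ MetJudgment.ok Γ t ∈ judgments
  generated : judgments = {j | MetDerives (equationalPart judgments) j}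

/-! ### Models -/

/-- A model of the signature `Ω`: an extended metric space `M` with a nonexpansive map
`M ^ A → M` for each operation symbol of arity `A`. -/
structure SigModel (Ω : MetricSignature.{u}) : Type (u + 1) where
  space : Met.{u}
  op : ∀ f : Ω.Op, NonexpMap (NonexpMap (Ω.arity f) space) space

namespace SigModel

variable {Ω : MetricSignature.{u}}

/-- Homomorphisms: nonexpansive maps that commute with the operations. -/
@[ext]
structure Hom (M N : SigModel Ω) where
  map : M.space ⟶ N.space
  map_op : ∀ (f : Ω.Op) (a : NonexpMap (Ω.arity f) M.space),
    map.toFun (M.op f a) = N.op f (NonexpMap.comp map a)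

instance : Category.{u} (SigModel Ω) where
  Hom := Hom
  id M := ⟨𝟙 M.space, fun _ _ => rfl⟩
  comp φ ψ := ⟨φ.map ≫ ψ.map, fun f a => by
    change ψ.map.toFun (φ.map.toFun _) = _
    rw [φ.map_op, ψ.map_op]; rfl⟩

/-- The functor that forgets the operations. -/
def forget (Ω : MetricSignature.{u}) : SigModel Ω ⥤ Met.{u} where
  obj M := M.space
  map φ := φ.map

/-- The interpretation of a preterm in a context. It is defined exactly when `M` satisfies
`Γ ⊢ t ok`, and is then a function on the assignments that satisfy `Γ`. -/
def interp (M : SigModel Ω) {X : Type v} (Γ : MetContext X) :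
    Preterm Ω X → Part (Γ.Assign M.space → M.space)
  | .var x => Part.some (fun α => α.1 x)
  | .app f t =>
    { Dom := ∃ h : ∀ i, (M.interp Γ (t i)).Dom, ∀ i j α,
        edist ((M.interp Γ (t i)).get (h i) α) ((M.interp Γ (t j)).get (h j) α) ≤ edist i j
      get := fun h α => M.op f
        ⟨fun i => (M.interp Γ (t i)).get (h.1 i) α, fun i j => h.2 i j α⟩ }

/-- `M` satisfies a judgment. -/
def Satisfies (M : SigModel Ω) : MetJudgment Ω → Prop
  | .ok Γ t => (M.interp Γ t).Dom
  | .eq Γ s t ε => ∃ (hs : (M.interp Γ s).Dom) (ht : (M.interp Γ t).Dom),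
      ∀ α, edist ((M.interp Γ s).get hs α) ((M.interp Γ t).get ht α) ≤ ε

end SigModel

namespace MetricEquationalTheory

variable {Ω : MetricSignature.{u}} (T : MetricEquationalTheory Ω)

/-- The category of models of a theory: the full subcategory of the models of its signature that
satisfy every judgment of the theory. -/
abbrev Mod : Type (u + 1) :=
  ObjectProperty.FullSubcategory (fun M : SigModel Ω => ∀ j ∈ T.judgments, M.Satisfies j)

/-- The forgetful functor to `Met`. -/
def forget : T.Mod ⥤ Met.{u} := ObjectProperty.ι _ ⋙ SigModel.forget Ω

end MetricEquationalTheory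

/-! ### Countable arity -/

/-- `ℵ₁` is regular, so that `ℵ₁`-filtered categories and `ℵ₁`-accessible functors make sense:
a functor is `ℵ₁`-accessible if it preserves all small countably filtered colimits. -/
instance fact_isRegular_aleph_one : Fact (ℵ₁ : Cardinal.{u}).IsRegular :=
  ⟨Cardinal.isRegular_aleph_one⟩

/-! ### Satisfaction of judgments and homomorphisms -/

namespace SigModel

variable {Ω : MetricSignature.{u}}

/-- The image of an assignment under a homomorphism. -/
def Hom.assign {M N : SigModel Ω} (φ : Hom M N) {X : Type v} {Γ : MetContext X}
    (α : Γ.Assign M.space) : Γ.Assign N.space :=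
  ⟨fun x => φ.map.toFun (α.1 x), fun e he => (φ.map.nonexpansive _ _).trans (α.2 e he)⟩

/-- Homomorphisms commute with the interpretation of preterms. -/
theorem Hom.map_interp {M N : SigModel Ω} (φ : Hom M N) {X : Type v} (Γ : MetContext X)
    (α : Γ.Assign M.space) : ∀ (t : Preterm Ω X) (hM : (M.interp Γ t).Dom)
    (hN : (N.interp Γ t).Dom),
      φ.map.toFun ((M.interp Γ t).get hM α) = (N.interp Γ t).get hN (φ.assign α)
  | .var _, _, _ => rfl
  | .app f t, hM, hN => by
    refine (φ.map_op f _).trans ?_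
    change N.op f _ = N.op f _
    congr 1
    ext i
    exact φ.map_interp Γ α (t i) (hM.1 i) (hN.1 i)

/-- A structure with a jointly isometric family of homomorphisms to models is a model. -/
theorem satisfies_of_jointly_isometric {F : SigModel Ω} {ι : Sort w} {M : ι → SigModel Ω}
    (φ : ∀ k, Hom F (M k))
    (hφ : ∀ p q r, (∀ k, edist ((φ k).map.toFun p) ((φ k).map.toFun q) ≤ r) → edist p q ≤ r)
    (j : MetJudgment Ω) (hj : ∀ k, (M k).Satisfies j) : F.Satisfies j := by
  have dom : ∀ (Γ : MetContext ℕ) (t : Preterm Ω ℕ), (∀ k, ((M k).interp Γ t).Dom) →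
      (F.interp Γ t).Dom := by
    intro Γ t
    induction t with
    | var x => exact fun _ => trivial
    | app f t ih =>
      intro h
      refine ⟨fun i => ih i fun k => (h k).1 i, fun i j α => hφ _ _ _ fun k => ?_⟩
      rw [(φ k).map_interp Γ α (t i) _ ((h k).1 i), (φ k).map_interp Γ α (t j) _ ((h k).1 j)]
      exact (h k).2 i j _
  cases j with
  | ok Γ t => exact dom Γ t hj
  | eq Γ s t ε =>
    choose hs ht h using hj
    refine ⟨dom Γ s hs, dom Γ t ht, fun α => hφ _ _ _ fun k => ?_⟩
    rw [(φ k).map_interp Γ α s _ (hs k), (φ k).map_interp Γ α t _ (ht k)]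
    exact h k _

/-- A structure all of whose assignments come from models is a model. -/
theorem satisfies_of_lift_assign {M : SigModel Ω} (j : MetJudgment Ω)
    (h : ∀ (Γ : MetContext ℕ) (α : Γ.Assign M.space), ∃ (K : SigModel Ω) (φ : Hom K M)
      (β : Γ.Assign K.space), K.Satisfies j ∧ φ.assign β = α) : M.Satisfies j := by
  have dom : ∀ (Γ : MetContext ℕ) (t : Preterm Ω ℕ),
      (∀ α : Γ.Assign M.space, ∃ (K : SigModel Ω) (φ : Hom K M)
        (β : Γ.Assign K.space), (K.interp Γ t).Dom ∧ φ.assign β = α) → (M.interp Γ t).Dom := by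
    intro Γ t
    induction t with
    | var x => exact fun _ => trivial
    | app f t ih =>
      intro h
      have hd : ∀ i, (M.interp Γ (t i)).Dom := fun i => ih i fun α => by
        obtain ⟨K, φ, β, hK, e⟩ := h α
        exact ⟨K, φ, β, hK.1 i, e⟩
      refine ⟨hd, fun i j α => ?_⟩
      obtain ⟨K, φ, β, hK, rfl⟩ := h α
      rw [← φ.map_interp Γ β (t i) (hK.1 i), ← φ.map_interp Γ β (t j) (hK.1 j)]
      exact (φ.map.nonexpansive _ _).trans (hK.2 i j β)
  cases j with
  | ok Γ t => exact dom Γ t (h Γ)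
  | eq Γ s t ε =>
    refine ⟨dom Γ s fun α => ?_, dom Γ t fun α => ?_, fun α => ?_⟩
    · obtain ⟨K, φ, β, ⟨hs, _, _⟩, e⟩ := h Γ α
      exact ⟨K, φ, β, hs, e⟩
    · obtain ⟨K, φ, β, ⟨_, ht, _⟩, e⟩ := h Γ α
      exact ⟨K, φ, β, ht, e⟩
    · obtain ⟨K, φ, β, ⟨hs, ht, hd⟩, rfl⟩ := h Γ α
      rw [← φ.map_interp Γ β s hs, ← φ.map_interp Γ β t ht]
      exact (φ.map.nonexpansive _ _).trans (hd β)

/-- The value of a preterm at a single assignment, as a relation. -/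
inductive Eval (M : SigModel Ω) {X : Type v} (h : X → M.space) : Preterm Ω X → M.space → Prop
  | var (x : X) : Eval M h (.var x) (h x)
  | app (f : Ω.Op) (t : Ω.arity f → Preterm Ω X) (a : NonexpMap (Ω.arity f) M.space) :
      (∀ i, Eval M h (t i) (a i)) → Eval M h (.app f t) (M.op f a)

theorem Eval.unique {M : SigModel Ω} {X : Type v} {h : X → M.space} {t : Preterm Ω X}
    {a b : M.space} (ha : Eval M h t a) (hb : Eval M h t b) : a = b := by
  induction ha generalizing b with
  | var x => cases hb; rfl
  | app f t a _ ih =>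
    cases hb with
    | app _ _ a' hb =>
      congr 1
      ext i
      exact ih i (hb i)

end SigModel

/-! ### Free models -/

namespace MetricEquationalTheory

variable {Ω : MetricSignature.{u}} (T : MetricEquationalTheory Ω)

/-- The preterms over `X` with a value in each model under each nonexpansive assignment. -/
def FreeTerm (X : Type u) [EMetricSpace X] : Type u :=
  {t : Preterm Ω X // ∀ (M : T.Mod) (h : NonexpMap X M.obj.space), ∃ a, M.obj.Eval h.toFun t a}

namespace FreeTerm

variable {T} {X : Type u} [EMetricSpace X]

/-- The value of a term in a model. -/
noncomputable def eval (M : T.Mod) (h : NonexpMap X M.obj.space) (t : T.FreeTerm X) :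
    M.obj.space := (t.2 M h).choose

theorem eval_spec (M : T.Mod) (h : NonexpMap X M.obj.space) (t : T.FreeTerm X) :
    M.obj.Eval h.toFun t.1 (eval M h t) := (t.2 M h).choose_spec

theorem eval_eq {M : T.Mod} {h : NonexpMap X M.obj.space} {t : T.FreeTerm X} {a : M.obj.space}
    (ha : M.obj.Eval h.toFun t.1 a) : eval M h t = a := (eval_spec M h t).unique ha

/-- The largest pseudometric compatible with the values in all models. -/
noncomputable instance : PseudoEMetricSpace (T.FreeTerm X) where
  edist s t := ⨆ (M : T.Mod) (h : NonexpMap X M.obj.space), edist (eval M h s) (eval M h t)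
  edist_self s := by simp
  edist_comm s t := by simp only [edist_comm]
  edist_triangle s t r := iSup₂_le fun M h => (edist_triangle _ (eval M h t) _).trans
    (add_le_add (le_iSup₂ (f := fun (M : T.Mod) (h : NonexpMap X M.obj.space) =>
        edist (eval M h s) (eval M h t)) M h)
      (le_iSup₂ (f := fun (M : T.Mod) (h : NonexpMap X M.obj.space) =>
        edist (eval M h t) (eval M h r)) M h))

theorem edist_le {s t : T.FreeTerm X} {r : ℝ≥0∞}
    (h : ∀ (M : T.Mod) (h : NonexpMap X M.obj.space), edist (eval M h s) (eval M h t) ≤ r) :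
    edist s t ≤ r := iSup₂_le h

theorem edist_eval_le (M : T.Mod) (h : NonexpMap X M.obj.space) (s t : T.FreeTerm X) :
    edist (eval M h s) (eval M h t) ≤ edist s t :=
  le_iSup₂ (f := fun (M : T.Mod) (h : NonexpMap X M.obj.space) =>
        edist (eval M h s) (eval M h t)) M h

variable (T) in
/-- A variable as a term. -/
def var (x : X) : T.FreeTerm X := ⟨.var x, fun _ h => ⟨h.toFun x, .var x⟩⟩

/-- An operation applied to a nonexpansive family of terms. -/
def app (f : Ω.Op) (t : Ω.arity f → T.FreeTerm X) (ht : ∀ i j, edist (t i) (t j) ≤ edist i j) :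
    T.FreeTerm X :=
  ⟨.app f fun i => (t i).1, fun M h => ⟨_, .app f _ ⟨fun i => eval M h (t i), fun i j =>
    (edist_eval_le M h _ _).trans (ht i j)⟩ fun i => eval_spec M h (t i)⟩⟩

end FreeTerm

/-- The points of the free model on `X`. -/
abbrev FreeSpace (X : Type u) [EMetricSpace X] : Type u := SeparationQuotient (T.FreeTerm X)

section

variable {T} {X : Type u} [EMetricSpace X]

theorem FreeTerm.edist_out (p q : T.FreeSpace X) :
    edist (Quotient.out p : T.FreeTerm X) (Quotient.out q) = edist p q := by
  conv_rhs => rw [← Quotient.out_eq p, ← Quotient.out_eq q]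
  exact (SeparationQuotient.edist_mk _ _).symm

/-- The value of a point of the free model in a model. -/
noncomputable def FreeSpace.eval (M : T.Mod) (h : NonexpMap X M.obj.space) (p : T.FreeSpace X) :
    M.obj.space := FreeTerm.eval M h (Quotient.out p)

theorem FreeSpace.eval_mk (M : T.Mod) (h : NonexpMap X M.obj.space) (t : T.FreeTerm X) :
    FreeSpace.eval M h (SeparationQuotient.mk t) = FreeTerm.eval M h t := by
  refine edist_le_zero.1 ((FreeTerm.edist_eval_le M h _ _).trans ?_)
  rw [← SeparationQuotient.edist_mk]
  exact (edist_eq_zero.2 (show (SeparationQuotient.mk _ : T.FreeSpace X) = _ from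
    Quotient.out_eq _)).le

theorem FreeSpace.edist_eval_le (M : T.Mod) (h : NonexpMap X M.obj.space) (p q : T.FreeSpace X) :
    edist (FreeSpace.eval M h p) (FreeSpace.eval M h q) ≤ edist p q :=
  (FreeTerm.edist_eval_le M h _ _).trans (FreeTerm.edist_out p q).le

theorem FreeSpace.edist_le {p q : T.FreeSpace X} {r : ℝ≥0∞}
    (h : ∀ (M : T.Mod) (h : NonexpMap X M.obj.space),
      edist (FreeSpace.eval M h p) (FreeSpace.eval M h q) ≤ r) : edist p q ≤ r :=
  (FreeTerm.edist_out p q).symm.le.trans (FreeTerm.edist_le h)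

/-- The operations of the free model. -/
noncomputable def FreeSpace.op (f : Ω.Op) (a : NonexpMap (Ω.arity f) (T.FreeSpace X)) :
    T.FreeSpace X :=
  SeparationQuotient.mk (FreeTerm.app f (fun i => Quotient.out (a i)) fun i j =>
    (FreeTerm.edist_out _ _).le.trans (a.nonexpansive i j))

theorem FreeSpace.eval_op (M : T.Mod) (h : NonexpMap X M.obj.space) (f : Ω.Op)
    (a : NonexpMap (Ω.arity f) (T.FreeSpace X)) :
    FreeSpace.eval M h (FreeSpace.op f a) = M.obj.op f
      ⟨fun i => FreeSpace.eval M h (a i), fun i j =>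
        (FreeSpace.edist_eval_le M h _ _).trans (a.nonexpansive i j)⟩ :=
  (FreeSpace.eval_mk _ _ _).trans
    (FreeTerm.eval_eq (.app f _ _ fun _ => FreeTerm.eval_spec M h _))

end

/-- The free model on `X`, as a structure for the signature. -/
noncomputable def free (X : Type u) [EMetricSpace X] : SigModel Ω where
  space := ⟨T.FreeSpace X⟩
  op f := ⟨FreeSpace.op f, fun a b => FreeSpace.edist_le fun M h => by
    rw [FreeSpace.eval_op, FreeSpace.eval_op]
    refine ((M.obj.op f).nonexpansive _ _).trans (iSup_mono fun i => ?_)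
    exact FreeSpace.edist_eval_le M h _ _⟩

variable {X : Type u} [EMetricSpace X]

/-- The extension of a nonexpansive map to the free model. -/
noncomputable def lift (M : T.Mod) (h : NonexpMap X M.obj.space) : SigModel.Hom (T.free X) M.obj where
  map := ⟨FreeSpace.eval M h, FreeSpace.edist_eval_le M h⟩
  map_op f a := FreeSpace.eval_op M h f a

variable (X) in
/-- The free model on `X`. -/
noncomputable def freeMod : T.Mod where
  obj := T.free X
  property j hj := SigModel.satisfies_of_jointly_isometric
    (ι := Σ M : T.Mod, NonexpMap X M.obj.space) (M := fun k => k.1.obj)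
    (fun k => T.lift k.1 k.2)
    (fun _ _ _ h => FreeSpace.edist_le fun M k => h ⟨M, k⟩) j fun k => k.1.property j hj

variable (X) in
/-- The inclusion of the generators. -/
noncomputable def unit : NonexpMap X (T.free X).space where
  toFun x := SeparationQuotient.mk (FreeTerm.var T x)
  nonexpansive x y := FreeSpace.edist_le fun M h => by
    rw [FreeSpace.eval_mk, FreeSpace.eval_mk, FreeTerm.eval_eq (.var x), FreeTerm.eval_eq (.var y)]
    exact h.nonexpansive x y

@[simp]
theorem lift_unit (M : T.Mod) (h : NonexpMap X M.obj.space) (x : X) :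
    (T.lift M h).map.toFun (T.unit X x) = h x :=
  (FreeSpace.eval_mk M h _).trans (FreeTerm.eval_eq (.var x))

variable {T} in
/-- The free model is generated by the image of the unit. -/
theorem free_induction {P : (T.free X).space → Prop} (unit : ∀ x, P (T.unit X x))
    (op : ∀ (f : Ω.Op) (a : NonexpMap (Ω.arity f) (T.free X).space),
      (∀ i, P (a i)) → P ((T.free X).op f a)) (p : (T.free X).space) : P p := by
  obtain ⟨⟨t, ht⟩, rfl⟩ := SeparationQuotient.surjective_mk p
  induction t with
  | var x => exact unit x
  | app f t ih =>
    have key : ∀ (M : T.Mod) (h : NonexpMap X M.obj.space), ∃ a : NonexpMap (Ω.arity f) M.obj.space,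
        ∀ i, M.obj.Eval h.toFun (t i) (a i) := by
      intro M h
      obtain ⟨_, hb⟩ := ht M h
      cases hb with
      | app _ _ a ha => exact ⟨a, ha⟩
    let s (i : Ω.arity f) : T.FreeTerm X := ⟨t i, fun M h => ⟨_, (key M h).choose_spec i⟩⟩
    have hs (M h i) : FreeTerm.eval M h (s i) = (key M h).choose i :=
      FreeTerm.eval_eq ((key M h).choose_spec i)
    let a : NonexpMap (Ω.arity f) (T.free X).space := ⟨fun i => SeparationQuotient.mk (s i),
      fun i j => FreeSpace.edist_le fun M h => by
        rw [FreeSpace.eval_mk, FreeSpace.eval_mk, hs, hs]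
        exact (key M h).choose.nonexpansive i j⟩
    have e : (T.free X).op f a = SeparationQuotient.mk ⟨.app f t, ht⟩ := by
      refine edist_le_zero.1 (FreeSpace.edist_le fun M h => ?_)
      refine (edist_eq_zero.2 ((FreeSpace.eval_op M h f a).trans (.trans (congrArg _ ?_)
        ((FreeSpace.eval_mk M h _).trans
          (FreeTerm.eval_eq (.app f t _ (key M h).choose_spec))).symm))).le
      ext i
      exact (FreeSpace.eval_mk M h _).trans (hs M h i)
    rw [← e]
    exact op f a fun i => ih i _

variable {T} in
/-- Homomorphisms on a free model are as close as they are on the generators. -/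
theorem edist_hom_le {M : SigModel Ω} (φ ψ : SigModel.Hom (T.free X) M) {r : ℝ≥0∞}
    (h : ∀ x, edist (φ.map.toFun (T.unit X x)) (ψ.map.toFun (T.unit X x)) ≤ r)
    (p : (T.free X).space) : edist (φ.map.toFun p) (ψ.map.toFun p) ≤ r := by
  induction p using free_induction with
  | unit x => exact h x
  | op f a ih =>
    rw [φ.map_op, ψ.map_op]
    exact ((M.op f).nonexpansive _ _).trans (iSup_le ih)

variable {T} in
theorem free_hom_ext {M : SigModel Ω} {φ ψ : SigModel.Hom (T.free X) M}
    (h : ∀ x, φ.map.toFun (T.unit X x) = ψ.map.toFun (T.unit X x)) : φ = ψ := by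
  apply SigModel.Hom.ext
  apply NonexpMap.ext
  funext p
  exact edist_le_zero.1 (edist_hom_le φ ψ (fun x => (edist_eq_zero.2 (h x)).le) p)

/-- The forgetful functor has a left adjoint. -/
theorem isRightAdjoint_forget : T.forget.IsRightAdjoint :=
  (Adjunction.adjunctionOfEquivLeft (G := T.forget) (F_obj := fun X : Met => T.freeMod X)
    (fun X M =>
      { toFun := fun φ => NonexpMap.comp φ.hom.map (T.unit X)
        invFun := fun h => ObjectProperty.homMk (T.lift M h)
        left_inv := fun _ => ObjectProperty.hom_ext _ (free_hom_ext fun x => T.lift_unit M _ x)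
        right_inv := fun h => NonexpMap.ext (funext fun x => T.lift_unit M h x) })
    (fun _ _ _ _ _ => rfl)).isRightAdjoint

end MetricEquationalTheory

/-! ### Countably filtered colimits of metric spaces -/

section FilteredColimits

open Limits

theorem hasCardinalLT_aleph_one (ι : Type v) [Countable ι] :
    HasCardinalLT ι (ℵ₁ : Cardinal.{u}) := by
  rw [HasCardinalLT, Cardinal.lift_aleph, Ordinal.lift_one, Cardinal.lt_aleph_one_iff,
    Cardinal.lift_le_aleph0]
  exact Cardinal.mk_le_aleph0

variable {J : Type u} [SmallCategory J]

theorem Met.map_comp_apply {G : J ⥤ Met.{u}} {l m n : J} (f : l ⟶ m) (g : m ⟶ n) (x : G.obj l) :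
    (G.map (f ≫ g)).toFun x = (G.map g).toFun ((G.map f).toFun x) := by
  rw [G.map_comp]; rfl

theorem Met.cocone_apply {G : J ⥤ Met.{u}} (s : Cocone G) {j l : J} (f : j ⟶ l) (x : G.obj j) :
    (s.ι.app l).toFun ((G.map f).toFun x) = (s.ι.app j).toFun x :=
  congrArg (fun φ : G.obj j ⟶ s.pt => φ.toFun x) (s.w f)

variable [IsCardinalFiltered J (ℵ₁ : Cardinal.{u})]

/-- Countably many properties that hold eventually hold simultaneously at a later stage. -/
theorem exists_common_stage {ι : Type v} [Countable ι] {j : J} (P : ι → ∀ l, (j ⟶ l) → Prop)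
    (hP : ∀ i l m (f : j ⟶ l) (g : l ⟶ m), P i l f → P i m (f ≫ g))
    (h : ∀ i, ∃ l f, P i l f) : ∃ l f, ∀ i, P i l f := by
  choose l f hf using h
  obtain ⟨m, a, b, e⟩ := IsCardinalFiltered.wideSpan f (hasCardinalLT_aleph_one ι)
  exact ⟨m, b, fun i => e i ▸ hP i _ _ _ (a i) (hf i)⟩

/-- The points of the diagram `G`. -/
def PreColim (G : J ⥤ Met.{u}) : Type u := Σ j, (G.obj j : Type u)

variable {G : J ⥤ Met.{u}}

/-- The infimum of the distances at all later stages. -/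
noncomputable instance : PseudoEMetricSpace (PreColim G) where
  edist x y := ⨅ (l) (f : x.1 ⟶ l) (g : y.1 ⟶ l), edist ((G.map f).toFun x.2) ((G.map g).toFun y.2)
  edist_self x := le_antisymm (iInf_le_of_le x.1 (iInf₂_le_of_le (𝟙 _) (𝟙 _) (by simp))) zero_le
  edist_comm x y := by
    simp only [edist_comm]
    exact iInf_congr fun l => iInf_comm
  edist_triangle x y z := by
    have := isFiltered_of_isCardinalFiltered J (ℵ₁ : Cardinal.{u})
    simp only [ENNReal.iInf_add, ENNReal.add_iInf]
    refine le_iInf fun l => le_iInf fun f => le_iInf fun g => le_iInf fun l' => le_iInf fun f' =>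
      le_iInf fun g' => ?_
    obtain ⟨m, a, b, e⟩ := IsFiltered.span g' f
    refine iInf_le_of_le m (iInf₂_le_of_le (f' ≫ a) (g ≫ b) ?_)
    refine (edist_triangle _ ((G.map (g' ≫ a)).toFun y.2) _).trans ?_
    conv_lhs => enter [2]; rw [e]
    simp only [Met.map_comp_apply]
    exact add_le_add ((G.map a).nonexpansive _ _) ((G.map b).nonexpansive _ _)

variable (G) in
/-- The colimit of a countably filtered diagram of metric spaces. -/
noncomputable def Met.colim : Met.{u} := ⟨SeparationQuotient (PreColim G)⟩

namespace Met.colim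

variable (G) in
/-- The maps into the colimit. -/
noncomputable def mk (j : J) : G.obj j ⟶ Met.colim G where
  toFun x := SeparationQuotient.mk (⟨j, x⟩ : PreColim G)
  nonexpansive x y := (SeparationQuotient.edist_mk _ _).trans_le
    (iInf_le_of_le j (iInf₂_le_of_le (𝟙 _) (𝟙 _) (by simp only [G.map_id]; exact le_rfl)))

theorem mk_surjective (p : Met.colim G) : ∃ j x, (mk G j).toFun x = p := by
  obtain ⟨⟨j, x⟩, rfl⟩ := SeparationQuotient.surjective_mk p
  exact ⟨j, x, rfl⟩

theorem edist_mk {j k : J} (x : G.obj j) (y : G.obj k) :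
    edist ((mk G j).toFun x) ((mk G k).toFun y) =
      ⨅ (l) (f : j ⟶ l) (g : k ⟶ l), edist ((G.map f).toFun x) ((G.map g).toFun y) :=
  SeparationQuotient.edist_mk _ _

theorem mk_map {j k : J} (f : j ⟶ k) (x : G.obj j) :
    (mk G k).toFun ((G.map f).toFun x) = (mk G j).toFun x := by
  refine edist_le_zero.1 ((edist_mk _ _).trans_le
    (iInf_le_of_le k (iInf₂_le_of_le (𝟙 _) f ?_)))
  rw [G.map_id]
  exact (edist_self _).le

/-- Distances in the colimit are attained at some stage. -/
theorem exists_edist_le {j : J} {x y : G.obj j} {r : ℝ≥0∞}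
    (h : edist ((mk G j).toFun x) ((mk G j).toFun y) ≤ r) :
    ∃ (l : J) (f : j ⟶ l), edist ((G.map f).toFun x) ((G.map f).toFun y) ≤ r := by
  obtain rfl | hr := eq_top_or_lt_top r
  · exact ⟨j, 𝟙 _, le_top⟩
  obtain ⟨u, -, hu, hlim⟩ := exists_seq_strictAnti_tendsto' hr
  have := isFiltered_of_isCardinalFiltered J (ℵ₁ : Cardinal.{u})
  obtain ⟨l, f, hf⟩ := exists_common_stage (j := j)
    (fun n l f => edist ((G.map f).toFun x) ((G.map f).toFun y) ≤ u n)
    (fun n l m f g h => by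
      simp only [Met.map_comp_apply]
      exact ((G.map g).nonexpansive _ _).trans h)
    (fun n => by
      have := h.trans_lt (hu n).1
      simp only [edist_mk, iInf_lt_iff] at this
      obtain ⟨l, f, g, hfg⟩ := this
      refine ⟨_, f ≫ IsFiltered.coeqHom f g, ?_⟩
      conv_lhs => enter [2]; rw [IsFiltered.coeq_condition]
      simp only [Met.map_comp_apply]
      exact ((G.map _).nonexpansive _ _).trans hfg.le)
  exact ⟨l, f, ge_of_tendsto' hlim hf⟩

theorem exists_forall_edist_le {ι : Type v} [Countable ι] {j : J} (x y : ι → G.obj j)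
    (r : ι → ℝ≥0∞) (h : ∀ i, edist ((mk G j).toFun (x i)) ((mk G j).toFun (y i)) ≤ r i) :
    ∃ (l : J) (f : j ⟶ l), ∀ i, edist ((G.map f).toFun (x i)) ((G.map f).toFun (y i)) ≤ r i :=
  exists_common_stage (fun i l f => edist ((G.map f).toFun (x i)) ((G.map f).toFun (y i)) ≤ r i)
    (fun i l m f g h => by
      simp only [Met.map_comp_apply]
      exact ((G.map g).nonexpansive _ _).trans h)
    fun i => exists_edist_le (h i)

/-- Countable families of points come from a single stage, where they satisfy any given countable
set of bounds on distances. -/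
theorem exists_lift {ι : Type v} [Countable ι] {κ : Type w} [Countable κ] (a : ι → Met.colim G)
    (s t : κ → ι) (r : κ → ℝ≥0∞) (h : ∀ k, edist (a (s k)) (a (t k)) ≤ r k) :
    ∃ (j : J) (b : ι → G.obj j), (∀ i, (mk G j).toFun (b i) = a i) ∧
      ∀ k, edist (b (s k)) (b (t k)) ≤ r k := by
  choose j x hx using fun i => mk_surjective (a i)
  let m := IsCardinalFiltered.max j (hasCardinalLT_aleph_one.{u} ι)
  let c (i : ι) : G.obj m :=
    (G.map (IsCardinalFiltered.toMax j (hasCardinalLT_aleph_one.{u} ι) i)).toFun (x i)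
  have hc (i : ι) : (mk G m).toFun (c i) = a i := (mk_map _ _).trans (hx i)
  obtain ⟨l, f, hf⟩ := exists_forall_edist_le (fun k => c (s k)) (fun k => c (t k)) r
    (fun k => by rw [hc, hc]; exact h k)
  exact ⟨l, fun i => (G.map f).toFun (c i), fun i => (mk_map f _).trans (hc i), hf⟩

theorem exists_lift_nonexpMap {N : Type v} [EMetricSpace N] [Countable N]
    (a : NonexpMap N (Met.colim G)) :
    ∃ (j : J) (b : NonexpMap N (G.obj j)), NonexpMap.comp (mk G j) b = a := by
  obtain ⟨j, b, hb, h⟩ := exists_lift (κ := N × N) a.toFun Prod.fst Prod.snd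
    (fun k => edist k.1 k.2) fun k => a.nonexpansive _ _
  exact ⟨j, ⟨b, fun x y => h (x, y)⟩, NonexpMap.ext (funext hb)⟩

variable (G) in
/-- The colimit cocone. -/
noncomputable def cocone : Cocone G where
  pt := Met.colim G
  ι :=
    { app := mk G
      naturality := fun _ _ f => NonexpMap.ext (funext fun x => mk_map f x) }

/-- The map out of the colimit. -/
noncomputable def desc (s : Cocone G) : Met.colim G ⟶ s.pt :=
  have key (x y : PreColim G) :
      edist ((s.ι.app x.1).toFun x.2) ((s.ι.app y.1).toFun y.2) ≤ edist x y :=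
    le_iInf fun l => le_iInf₂ fun f g => by
      rw [← Met.cocone_apply s f, ← Met.cocone_apply s g]
      exact (s.ι.app l).nonexpansive _ _
  { toFun := SeparationQuotient.lift (fun x : PreColim G => (s.ι.app x.1).toFun x.2)
      fun x y h => edist_le_zero.1 ((key x y).trans (EMetric.inseparable_iff.1 h).le)
    nonexpansive := fun p q => by
      obtain ⟨x, rfl⟩ := SeparationQuotient.surjective_mk p
      obtain ⟨y, rfl⟩ := SeparationQuotient.surjective_mk q
      exact (key x y).trans (SeparationQuotient.edist_mk _ _).ge }

variable (G) in
/-- The colimit cocone is a colimit. -/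
noncomputable def isColimit : IsColimit (cocone G) where
  desc := desc
  fac _ _ := rfl
  uniq s m h := NonexpMap.ext (funext fun p => by
    obtain ⟨j, x, rfl⟩ := mk_surjective p
    exact congrArg (fun φ : G.obj j ⟶ s.pt => φ.toFun x) (h j))

end Met.colim

/-! ### Countably filtered colimits of models -/

namespace MetricEquationalTheory

variable {Ω : MetricSignature.{u}} {T : MetricEquationalTheory Ω} (K : J ⥤ T.Mod)

theorem colim_mk_op {j k : J} (h : j ⟶ k) (f : Ω.Op)
    (c : NonexpMap (Ω.arity f) (K.obj j).obj.space) :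
    (Met.colim.mk (K ⋙ T.forget) j).toFun ((K.obj j).obj.op f c) =
      (Met.colim.mk (K ⋙ T.forget) k).toFun
        ((K.obj k).obj.op f (NonexpMap.comp (K.map h).hom.map c)) :=
  (Met.colim.mk_map (G := K ⋙ T.forget) h _).symm.trans
    (congrArg (Met.colim.mk (K ⋙ T.forget) k).toFun ((K.map h).hom.map_op f c))

theorem colim_edist_op {j k : J} (f : Ω.Op) (c : NonexpMap (Ω.arity f) (K.obj j).obj.space)
    (d : NonexpMap (Ω.arity f) (K.obj k).obj.space) :
    edist ((Met.colim.mk (K ⋙ T.forget) j).toFun ((K.obj j).obj.op f c))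
      ((Met.colim.mk (K ⋙ T.forget) k).toFun ((K.obj k).obj.op f d)) ≤
      edist (NonexpMap.comp (Met.colim.mk (K ⋙ T.forget) j) c)
        (NonexpMap.comp (Met.colim.mk (K ⋙ T.forget) k) d) := by
  have := isFiltered_of_isCardinalFiltered J (ℵ₁ : Cardinal.{u})
  let m := IsFiltered.max j k
  let c' := NonexpMap.comp (K.map (IsFiltered.leftToMax j k)).hom.map c
  let d' := NonexpMap.comp (K.map (IsFiltered.rightToMax j k)).hom.map d
  obtain ⟨l, h, hl⟩ := Met.colim.exists_forall_edist_le (G := K ⋙ T.forget) (j := m) c'.toFun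
    d'.toFun (fun i => edist ((Met.colim.mk (K ⋙ T.forget) j).toFun (c i))
        ((Met.colim.mk (K ⋙ T.forget) k).toFun (d i))) (fun i => by
      rw [← Met.colim.mk_map (G := K ⋙ T.forget) (IsFiltered.leftToMax j k) (c i),
        ← Met.colim.mk_map (G := K ⋙ T.forget) (IsFiltered.rightToMax j k) (d i)]
      exact le_rfl)
  rw [colim_mk_op K (IsFiltered.leftToMax j k), colim_mk_op K (IsFiltered.rightToMax j k),
    colim_mk_op K h, colim_mk_op K h]
  exact ((Met.colim.mk (K ⋙ T.forget) l).nonexpansive _ _).trans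
    (((K.obj l).obj.op f).nonexpansive _ _ |>.trans (iSup_mono hl))

/-- The value of an operation on the colimit. -/
noncomputable def colimOp (f : Ω.Op) (a : NonexpMap (Ω.arity f) (Met.colim (K ⋙ T.forget))) :
    Met.colim (K ⋙ T.forget) :=
  have h := Met.colim.exists_lift_nonexpMap a
  (Met.colim.mk (K ⋙ T.forget) h.choose).toFun ((K.obj h.choose).obj.op f h.choose_spec.choose)

theorem exists_colimOp_eq (f : Ω.Op) (a : NonexpMap (Ω.arity f) (Met.colim (K ⋙ T.forget))) :
    ∃ (j : J) (c : NonexpMap (Ω.arity f) (K.obj j).obj.space),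
      NonexpMap.comp (Met.colim.mk (K ⋙ T.forget) j) c = a ∧
      colimOp K f a = (Met.colim.mk (K ⋙ T.forget) j).toFun ((K.obj j).obj.op f c) :=
  ⟨_, _, (Met.colim.exists_lift_nonexpMap a).choose_spec.choose_spec, rfl⟩

/-- The colimit of models, as a structure for the signature. -/
noncomputable def colimModel : SigModel Ω where
  space := Met.colim (K ⋙ T.forget)
  op f := ⟨colimOp K f, fun a b => by
    obtain ⟨j, c, hc, ec⟩ := exists_colimOp_eq K f a
    obtain ⟨k, d, hd, ed⟩ := exists_colimOp_eq K f b
    rw [ec, ed, ← hc, ← hd]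
    exact colim_edist_op K f c d⟩

/-- The homomorphisms into the colimit of models. -/
noncomputable def colimMk (j : J) : SigModel.Hom (K.obj j).obj (colimModel K) where
  map := Met.colim.mk (K ⋙ T.forget) j
  map_op f a := by
    obtain ⟨k, d, hd, ed⟩ := exists_colimOp_eq K f
      (NonexpMap.comp (Met.colim.mk (K ⋙ T.forget) j) a)
    refine edist_le_zero.1 ((edist_eq_zero.2 ?_).le)
    refine Eq.trans ?_ ed.symm
    refine edist_le_zero.1 ((colim_edist_op K f a d).trans ?_)
    rw [hd, edist_self]

/-- The colimit cocone of models. -/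
noncomputable def colimCocone : Cocone K where
  pt :=
    { obj := colimModel K
      property := fun j hj => SigModel.satisfies_of_lift_assign j fun Γ α => by
        have := Γ.countable.to_subtype
        obtain ⟨k, b, hb, h⟩ := Met.colim.exists_lift (κ := Γ.eqs) α.1 (fun e => e.1.lhs)
          (fun e => e.1.rhs) (fun e => e.1.bound) fun e => α.2 e.1 e.2
        exact ⟨(K.obj k).obj, colimMk K k, ⟨b, fun e he => h ⟨e, he⟩⟩, (K.obj k).property j hj,
          Subtype.ext (funext hb)⟩ }
  ι :=
    { app := fun j => ObjectProperty.homMk (colimMk K j)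
      naturality := fun _ _ f => ObjectProperty.hom_ext _ (SigModel.Hom.ext
        ((Met.colim.cocone (K ⋙ T.forget)).ι.naturality f)) }

/-- The colimit cocone of models is a colimit. -/
noncomputable def isColimitColimCocone : IsColimit (colimCocone K) where
  desc s := ObjectProperty.homMk
    { map := Met.colim.desc (T.forget.mapCocone s)
      map_op := fun f a => by
        obtain ⟨j, c, rfl, e⟩ := exists_colimOp_eq K f a
        exact (congrArg (Met.colim.desc (T.forget.mapCocone s)).toFun e).trans
          ((s.ι.app j).hom.map_op f c) }
  fac s j := rfl
  uniq s m h := ObjectProperty.hom_ext _ (SigModel.Hom.ext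
    ((Met.colim.isColimit (K ⋙ T.forget)).uniq (T.forget.mapCocone s) m.hom.map fun j =>
      congrArg (fun φ : K.obj j ⟶ s.pt => φ.hom.map) (h j)))

instance : T.forget.IsCardinalAccessible (ℵ₁ : Cardinal.{u}) where
  preservesColimitOfShape _ _ _ := ⟨fun {K} =>
    preservesColimit_of_preserves_colimit_cocone (isColimitColimCocone K)
      (Met.colim.isColimit (K ⋙ T.forget))⟩

/-- Free-model monads preserve countably filtered colimits. -/
theorem isCardinalAccessible_monad (Free : Met.{u} ⥤ T.Mod) (adj : Free ⊣ T.forget) :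
    adj.toMonad.toFunctor.IsCardinalAccessible (ℵ₁ : Cardinal.{u}) := by
  have := adj.leftAdjoint_preservesColimits
  exact inferInstanceAs ((Free ⋙ T.forget).IsCardinalAccessible (ℵ₁ : Cardinal.{u}))

end MetricEquationalTheory

end FilteredColimits

/-! ### Powers -/

section Powers

variable {C : Type u} [Category.{v} C] [MetCategory C] {V : Type w} [EMetricSpace V]

theorem IsPower.exists_iso {P P' X : C} {π : V → (P ⟶ X)} {π' : V → (P' ⟶ X)}
    (h : IsPower V π) (h' : IsPower V π') : ∃ i : P ≅ P', ∀ v, i.hom ≫ π' v = π v := by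
  obtain ⟨f, hf, -⟩ := h'.lift P π h.nonexpansive
  obtain ⟨g, hg, -⟩ := h.lift P' π' h'.nonexpansive
  exact ⟨⟨f, g, (h.lift P π h.nonexpansive).unique (fun v => by rw [Category.assoc, hg, hf])
      (fun v => Category.id_comp _),
    (h'.lift P' π' h'.nonexpansive).unique (fun v => by rw [Category.assoc, hf, hg])
      (fun v => Category.id_comp _)⟩, hf⟩

theorem MetCategory.edist_comp_le_left {X Y Z : C} (f f' : X ⟶ Y) (g : Y ⟶ Z) :
    edist (f ≫ g) (f' ≫ g) ≤ edist f f' := by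
  simpa using MetCategory.edist_comp_le f f' g g

theorem MetCategory.edist_comp_le_right {X Y Z : C} (f : X ⟶ Y) (g g' : Y ⟶ Z) :
    edist (f ≫ g) (f ≫ g') ≤ edist g g' := by
  simpa using MetCategory.edist_comp_le f f g g'

theorem IsPower.of_iso {P P' X : C} {π : V → (P ⟶ X)} {π' : V → (P' ⟶ X)}
    (h' : IsPower V π') (i : P ≅ P') (hi : ∀ v, i.hom ≫ π' v = π v) : IsPower V π := by
  obtain rfl : (fun v => i.hom ≫ π' v) = π := funext hi
  refine ⟨fun v w => (MetCategory.edist_comp_le_right _ _ _).trans (h'.nonexpansive v w),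
    fun A φ hφ => ?_, fun A g h => ?_⟩
  · obtain ⟨g, hg, hu⟩ := h'.lift A φ hφ
    refine ⟨g ≫ i.inv, fun v => by simp [hg], fun k hk => ?_⟩
    rw [← hu (k ≫ i.hom) fun v => by simpa using hk v, Category.assoc, i.hom_inv_id,
      Category.comp_id]
  · simp only [← Category.assoc]
    rw [← h'.isometry]
    refine le_antisymm ?_ (MetCategory.edist_comp_le_left _ _ _)
    simpa using MetCategory.edist_comp_le_left (g ≫ i.hom) (h ≫ i.hom) i.inv

/-- It is enough to preserve one power of each object by each countable space. -/
theorem PreservesCountablePowers.of_exists {D : Type*} [Category* D] [MetCategory D] {F : C ⥤ D}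
    (h : ∀ (V : Type) [EMetricSpace V] [Countable V] (X : C), ∃ (P : C) (π : V → (P ⟶ X)),
      IsPower V π ∧ IsPower V (fun v => F.map (π v))) : PreservesCountablePowers F := by
  intro V _ _ P X π hπ
  obtain ⟨P', π', h₁, h₂⟩ := h V X
  obtain ⟨i, hi⟩ := hπ.exists_iso h₁
  exact h₂.of_iso (F.mapIso i) fun v => by rw [← hi v, F.map_comp]; rfl

end Powers

/-- A constant map. -/
def NonexpMap.const (X : Type u) {Y : Type v} [EMetricSpace X] [EMetricSpace Y] (y : Y) :
    NonexpMap X Y := ⟨fun _ => y, fun _ _ => (edist_self y).trans_le zero_le⟩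

theorem NonexpMap.edist_apply_le {X : Type u} {Y : Type v} [EMetricSpace X] [EMetricSpace Y]
    (f g : NonexpMap X Y) (x : X) : edist (f x) (g x) ≤ edist f g :=
  le_iSup (fun x => edist (f x) (g x)) x

/-- A point, as a morphism from the one-point space. -/
def Met.point {Y : Met.{u}} (y : Y) : (⟨PUnit.{u + 1}⟩ : Met.{u}) ⟶ Y := NonexpMap.const _ y

theorem Met.edist_point {Y : Met.{u}} (x y : Y) : edist (Met.point x) (Met.point y) = edist x y :=
  le_antisymm (iSup_le fun _ => le_rfl) (le_iSup_of_le ⟨⟩ le_rfl)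

/-- Powers in `Met` are computed on points. -/
theorem isPower_met_iff {V : Type w} [EMetricSpace V] {P X : Met.{u}} {π : V → (P ⟶ X)} :
    IsPower V π ↔ Nonexpansive π ∧
      (∀ φ : NonexpMap V X, ∃ p : P, ∀ v, (π v).toFun p = φ v) ∧
      ∀ p q : P, edist p q = ⨆ v, edist ((π v).toFun p) ((π v).toFun q) := by
  constructor
  · intro h
    refine ⟨h.nonexpansive, fun φ => ?_, fun p q => ?_⟩
    · obtain ⟨g, hg, -⟩ := h.lift ⟨PUnit.{u + 1}⟩ (fun v => Met.point (φ v))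
        fun v w => (Met.edist_point _ _).trans_le (φ.nonexpansive v w)
      exact ⟨g.toFun ⟨⟩, fun v =>
        congrArg (fun k : (⟨PUnit.{u + 1}⟩ : Met.{u}) ⟶ X => k.toFun ⟨⟩) (hg v)⟩
    · refine (Met.edist_point p q).symm.trans ((h.isometry ⟨PUnit.{u + 1}⟩ _ _).trans ?_)
      exact iSup_congr fun v => Met.edist_point ((π v).toFun p) ((π v).toFun q)
  · rintro ⟨h₁, h₂, h₃⟩
    have ext {p q : P} (h : ∀ v, (π v).toFun p = (π v).toFun q) : p = q := by
      refine edist_le_zero.1 ((h₃ p q).trans_le (iSup_le fun v => ?_))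
      rw [h v, edist_self]
    refine ⟨h₁, fun A φ hφ => ?_, fun A g h => ?_⟩
    · choose g hg using fun a : A => h₂ ⟨fun v => (φ v).toFun a, fun v w =>
        (NonexpMap.edist_apply_le _ _ a).trans (hφ v w)⟩
      refine ⟨⟨g, fun a b => (h₃ _ _).trans_le (iSup_le fun v => ?_)⟩,
        fun v => NonexpMap.ext (funext fun a => hg a v),
        fun k hk => NonexpMap.ext (funext fun a => ext fun v => ?_)⟩
      · rw [hg, hg]
        exact (φ v).nonexpansive a b
      · exact (congrArg (fun k => NonexpMap.toFun k a) (hk v)).trans (hg a v).symm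
    · refine (iSup_congr fun a => h₃ (g.toFun a) (h.toFun a)).trans ?_
      exact iSup_comm

/-! ### Tensors of metric spaces -/

/-- The product of two sets, to be given the sum metric. -/
def MetTensor (V : Type v) (X : Type u) : Type max u v := V × X

namespace MetTensor

variable {V : Type v} {X : Type u} {A : Type w} [EMetricSpace V] [EMetricSpace X] [EMetricSpace A]

/-- The sum metric. -/
noncomputable instance : EMetricSpace (MetTensor V X) where
  edist p q := edist p.1 q.1 + edist p.2 q.2
  edist_self p := by simp
  edist_comm p q := by simp only [edist_comm]
  edist_triangle p q r := (add_le_add (edist_triangle _ q.1 _) (edist_triangle _ q.2 _)).trans_eq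
    (add_add_add_comm _ _ _ _)
  eq_of_edist_eq_zero h := Prod.ext (eq_of_edist_eq_zero (add_eq_zero.1 h).1)
    (eq_of_edist_eq_zero (add_eq_zero.1 h).2)

theorem edist_def (p q : MetTensor V X) : edist p q = edist p.1 q.1 + edist p.2 q.2 := rfl

instance [Countable V] [Countable X] : Countable (MetTensor V X) :=
  inferInstanceAs (Countable (V × X))

variable (X) in
/-- The inclusion of `X` at a point of `V`. -/
def incl (v : V) : NonexpMap X (MetTensor V X) :=
  ⟨fun x => (v, x), fun x y => (edist_def _ _).trans_le (by simp)⟩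

theorem nonexpansive_incl : Nonexpansive (incl X : V → NonexpMap X (MetTensor V X)) :=
  fun v w => iSup_le fun x => (edist_def _ _).trans_le (by simp [incl])

/-- The map out of the tensor given by a nonexpansive family of maps. -/
def desc (φ : NonexpMap V (NonexpMap X A)) : NonexpMap (MetTensor V X) A where
  toFun p := φ p.1 p.2
  nonexpansive p q := (edist_triangle _ (φ q.1 p.2) _).trans (add_le_add
    (((φ p.1).edist_apply_le (φ q.1) p.2).trans (φ.nonexpansive _ _)) ((φ q.1).nonexpansive _ _))

end MetTensor

/-- The tensor of countable spaces. -/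
noncomputable def CMet.tensor (V : Type) [EMetricSpace V] [Countable V] (X : CMet.{u}) : CMet.{u} where
  obj := ⟨MetTensor V X.obj⟩
  property := by have := X.property; exact inferInstanceAs (Countable (MetTensor V X.obj))

/-- The projections from the tensor, as a power in the opposite category. -/
noncomputable def CMet.tensorProj {V : Type} [EMetricSpace V] [Countable V] (X : CMet.{u}) (v : V) :
    op (CMet.tensor V X) ⟶ op X :=
  Quiver.Hom.op (ObjectProperty.homMk (MetTensor.incl X.obj v))

theorem CMet.isPower_tensorProj (V : Type) [EMetricSpace V] [Countable V] (X : CMet.{u}) :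
    IsPower V (CMet.tensorProj X : V → _) where
  nonexpansive := MetTensor.nonexpansive_incl
  lift A φ hφ := by
    refine ⟨Quiver.Hom.op (ObjectProperty.homMk (MetTensor.desc ⟨fun v => (φ v).unop.hom, hφ⟩)),
      fun v => rfl, fun g hg => ?_⟩
    refine Quiver.Hom.unop_inj (ObjectProperty.hom_ext _ (NonexpMap.ext (funext fun p => ?_)))
    exact congrArg (fun k : A ⟶ op X => NonexpMap.toFun k.unop.hom p.2) (hg p.1)
  isometry A g h := le_antisymm
    (iSup_le fun p => le_iSup_of_le p.1 (le_iSup_of_le p.2 le_rfl))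
    (iSup_le fun _ => MetCategory.edist_comp_le_left _ _ _)

/-! ### The Lawvere theory of a metric equational theory -/

namespace SigModel

variable {Ω : MetricSignature.{u}}

/-- The supremum metric on homomorphisms. -/
noncomputable instance : MetCategory (SigModel Ω) where
  homMetric M N := EMetricSpace.induced (fun φ : Hom M N => φ.map)
    (fun _ _ h => Hom.ext h) inferInstance
  edist_comp_le f f' g g' := MetCategory.edist_comp_le f.map f'.map g.map g'.map

theorem edist_hom_apply_le {M N : SigModel Ω} (φ ψ : M ⟶ N) (p : M.space) :
    edist (φ.map.toFun p) (ψ.map.toFun p) ≤ edist φ ψ :=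
  NonexpMap.edist_apply_le φ.map ψ.map p

end SigModel

namespace MetricEquationalTheory

variable {Ω : MetricSignature.{u}} (T : MetricEquationalTheory Ω)

section Homs

variable {X : Type u} {Y : Type u} [EMetricSpace X] [EMetricSpace Y]

/-- The extension of a nonexpansive map, as a morphism. -/
noncomputable def liftHom (M : T.Mod) (h : NonexpMap X M.obj.space) : T.free X ⟶ M.obj := T.lift M h

theorem liftHom_unit (M : T.Mod) (h : NonexpMap X M.obj.space) (x : X) :
    (T.liftHom M h).map.toFun (T.unit X x) = h x := T.lift_unit M h x

/-- The homomorphism of free models induced by a nonexpansive map. -/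
noncomputable def freeMap (f : NonexpMap X Y) : T.free X ⟶ T.free Y :=
  T.liftHom (T.freeMod Y) (NonexpMap.comp (T.unit Y) f)

theorem freeMap_unit (f : NonexpMap X Y) (x : X) :
    (T.freeMap f).map.toFun (T.unit X x) = T.unit Y (f x) := T.lift_unit (T.freeMod Y) _ x

variable {T}

theorem hom_ext {M : SigModel Ω} {φ ψ : T.free X ⟶ M}
    (h : ∀ x, φ.map.toFun (T.unit X x) = ψ.map.toFun (T.unit X x)) : φ = ψ := free_hom_ext h

theorem edist_le_of_unit {M : SigModel Ω} {φ ψ : T.free X ⟶ M} {r : ℝ≥0∞}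
    (h : ∀ x, edist (φ.map.toFun (T.unit X x)) (ψ.map.toFun (T.unit X x)) ≤ r) :
    edist φ ψ ≤ r := iSup_le fun p => edist_hom_le φ ψ h p

theorem edist_liftHom_le (M : T.Mod) (h k : NonexpMap X M.obj.space) :
    edist (T.liftHom M h) (T.liftHom M k) ≤ edist h k :=
  edist_le_of_unit fun x => by
    rw [liftHom_unit, liftHom_unit]
    exact NonexpMap.edist_apply_le h k x

theorem edist_freeMap_le (f g : NonexpMap X Y) : edist (T.freeMap f) (T.freeMap g) ≤ edist f g :=
  (edist_liftHom_le _ _ _).trans (iSup_mono fun _ => (T.unit Y).nonexpansive _ _)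

/-- The homomorphism that picks a point of a model. -/
noncomputable def point (M : T.Mod) (m : M.obj.space) : T.free PUnit.{u + 1} ⟶ M.obj :=
  T.liftHom M (NonexpMap.const _ m)

/-- The point picked by a homomorphism. -/
noncomputable def eval {M : SigModel Ω} (φ : T.free PUnit.{u + 1} ⟶ M) : M.space :=
  φ.map.toFun (T.unit _ ⟨⟩)

theorem eval_point (M : T.Mod) (m : M.obj.space) : eval (point M m) = m := T.liftHom_unit M _ _

theorem eval_comp {M N : SigModel Ω} (φ : T.free PUnit.{u + 1} ⟶ M) (ψ : M ⟶ N) :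
    eval (φ ≫ ψ) = ψ.map.toFun (eval φ) := rfl

theorem eval_injective {M : SigModel Ω} {φ ψ : T.free PUnit.{u + 1} ⟶ M} (h : eval φ = eval ψ) :
    φ = ψ := hom_ext fun _ => h

theorem point_eval (M : T.Mod) (φ : T.free PUnit.{u + 1} ⟶ M.obj) : point M (eval φ) = φ :=
  eval_injective (eval_point _ _)

theorem point_comp (M N : T.Mod) (m : M.obj.space) (φ : M.obj ⟶ N.obj) :
    point M m ≫ φ = point N (φ.map.toFun m) :=
  eval_injective (by rw [eval_comp, eval_point, eval_point])

theorem edist_point_le (M : T.Mod) (m m' : M.obj.space) :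
    edist (point M m) (point M m') ≤ edist m m' :=
  (edist_liftHom_le _ _ _).trans (iSup_le fun _ => le_rfl)

theorem edist_eval_le {M : SigModel Ω} (φ ψ : T.free PUnit.{u + 1} ⟶ M) :
    edist (eval φ) (eval ψ) ≤ edist φ ψ := SigModel.edist_hom_apply_le φ ψ _


end Homs

section Tensor

variable {T} {V : Type} [EMetricSpace V] {X : Type u} [EMetricSpace X]

theorem exists_tensor_lift (M : T.Mod) (φ : V → (T.free X ⟶ M.obj)) (hφ : Nonexpansive φ) :
    ∃ g : T.free (MetTensor V X) ⟶ M.obj, ∀ v, T.freeMap (MetTensor.incl X v) ≫ g = φ v := by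
  refine ⟨T.liftHom M (MetTensor.desc ⟨fun v => NonexpMap.comp (φ v).map (T.unit X),
    fun v w => (iSup_le fun x => ?_)⟩), fun v => hom_ext fun x => ?_⟩
  · exact (SigModel.edist_hom_apply_le (φ v) (φ w) _).trans (hφ v w)
  · refine (congrArg (T.liftHom M _).map.toFun (T.freeMap_unit (MetTensor.incl X v) x)).trans ?_
    exact T.liftHom_unit M _ _

theorem tensor_isometry {M : SigModel Ω} (g h : T.free (MetTensor V X) ⟶ M) :
    edist g h = ⨆ v : V, edist (T.freeMap (MetTensor.incl X v) ≫ g)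
      (T.freeMap (MetTensor.incl X v) ≫ h) := by
  refine le_antisymm (edist_le_of_unit fun p => le_iSup_of_le p.1 ?_)
    (iSup_le fun v => MetCategory.edist_comp_le_right _ _ _)
  have key (k : T.free (MetTensor V X) ⟶ M) : k.map.toFun (T.unit (MetTensor V X) p) =
      (T.freeMap (MetTensor.incl X p.1) ≫ k).map.toFun (T.unit X p.2) :=
    (congrArg k.map.toFun (T.freeMap_unit (MetTensor.incl X p.1) p.2)).symm
  rw [key g, key h]
  exact SigModel.edist_hom_apply_le _ _ _

end Tensor

/-- The objects of the Lawvere theory: the countable metric spaces. -/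
structure TheoryObj (T : MetricEquationalTheory Ω) : Type (u + 1) where
  space : CMet.{u}

namespace TheoryObj

variable {T}

/-- The free model on an object. -/
noncomputable abbrev freeMod (A : TheoryObj T) : T.Mod := T.freeMod A.space.obj

/-- The opposite of the category of countably generated free models. -/
noncomputable instance : Category.{u} (TheoryObj T) where
  Hom A B := B.freeMod.obj ⟶ A.freeMod.obj
  id A := 𝟙 A.freeMod.obj
  comp f g := @CategoryStruct.comp (SigModel Ω) _ _ _ _ g f
  id_comp _ := rfl
  comp_id _ := rfl
  assoc _ _ _ := rfl

/-- The morphism given by a homomorphism of free models. -/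
def ofHom {A B : TheoryObj T} (φ : B.freeMod.obj ⟶ A.freeMod.obj) : A ⟶ B := φ

/-- The homomorphism of free models underlying a morphism. -/
def toHom {A B : TheoryObj T} (φ : A ⟶ B) : B.freeMod.obj ⟶ A.freeMod.obj := φ

noncomputable instance : MetCategory (TheoryObj T) where
  homMetric A B := inferInstanceAs (EMetricSpace (B.freeMod.obj ⟶ A.freeMod.obj))
  edist_comp_le f f' g g' :=
    (MetCategory.edist_comp_le (toHom g) (toHom g') (toHom f) (toHom f')).trans_eq (add_comm _ _)

variable (T) in
/-- The image of the one-point space. -/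
noncomputable def gen : TheoryObj T := ⟨CMet.point⟩

/-- A point of a free model, as a morphism. -/
noncomputable def elt {A : TheoryObj T} (p : A.freeMod.obj.space) : A ⟶ gen T :=
  ofHom (point A.freeMod p)

theorem comp_elt {A B : TheoryObj T} (φ : A ⟶ B) (p : B.freeMod.obj.space) :
    φ ≫ elt p = elt ((toHom φ).map.toFun p) := point_comp B.freeMod A.freeMod p (toHom φ)

theorem edist_elt_le {A : TheoryObj T} (p q : A.freeMod.obj.space) :
    edist (elt p) (elt q) ≤ edist p q := edist_point_le A.freeMod p q

/-- The projections that present an object as a power of the generator. -/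
noncomputable def proj {A : TheoryObj T} (x : A.space.obj) : A ⟶ gen T := elt (T.unit _ x)

theorem comp_proj {A B : TheoryObj T} (φ : A ⟶ B) (x : B.space.obj) :
    φ ≫ proj x = elt ((toHom φ).map.toFun (T.unit B.space.obj x)) := comp_elt φ _

theorem eval_toHom_elt {A : TheoryObj T} (p : A.freeMod.obj.space) : eval (toHom (elt p)) = p :=
  eval_point A.freeMod p

variable (T) in
/-- The functor from countable metric spaces. -/
noncomputable def functor : CMet.{u}ᵒᵖ ⥤ TheoryObj T where
  obj X := ⟨X.unop⟩
  map f := ofHom (T.freeMap f.unop.hom)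
  map_id _ := hom_ext fun x => T.freeMap_unit _ x
  map_comp f g := hom_ext fun x => (T.freeMap_unit _ x).trans
    (((congrArg (T.freeMap f.unop.hom).map.toFun (T.freeMap_unit g.unop.hom x)).trans
      (T.freeMap_unit _ _)).symm)

theorem isPower_functor_tensorProj (V : Type) [EMetricSpace V] [Countable V] (X : CMet.{u}) :
    IsPower V (fun v : V => (functor T).map (CMet.tensorProj X v)) where
  nonexpansive v w := (edist_freeMap_le _ _).trans (MetTensor.nonexpansive_incl v w)
  lift A φ hφ := by
    obtain ⟨g, hg⟩ := exists_tensor_lift A.freeMod (fun v => toHom (φ v)) hφ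
    refine ⟨ofHom g, hg, fun k hk => edist_le_zero.1 ?_⟩
    refine (tensor_isometry (toHom k) g).trans_le (iSup_le fun v => ?_)
    exact (edist_eq_zero.2 ((hk v).trans (hg v).symm)).le
  isometry A g h := tensor_isometry (toHom g) (toHom h)

theorem isMetFunctor_functor : IsMetFunctor (functor T) := fun _ _ _ _ => edist_freeMap_le _ _

theorem preservesCountablePowers_functor : PreservesCountablePowers (functor T) :=
  .of_exists fun V _ _ X => ⟨_, _, CMet.isPower_tensorProj V X.unop,
    isPower_functor_tensorProj V X.unop⟩

end TheoryObj

/-- The Lawvere theory: the opposite of the category of countably generated free models. -/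
@[reducible]
noncomputable def lawvereTheory : MetLawvereTheory.{u} where
  Obj := TheoryObj T
  functor := TheoryObj.functor T
  bijective_obj := ⟨fun _ _ h => Opposite.unop_injective (congrArg TheoryObj.space h),
    fun A => ⟨op A.space, rfl⟩⟩
  enriched := TheoryObj.isMetFunctor_functor
  preservesPowers := TheoryObj.preservesCountablePowers_functor

/-! ### The nerve of a model -/

variable {T}

/-- Homomorphisms from countably generated free models to a model. -/
noncomputable def nerveObj (M : T.Mod) : TheoryObj T ⥤ Met.{u} where
  obj A := ⟨A.freeMod.obj ⟶ M.obj⟩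
  map φ := ⟨fun h => TheoryObj.toHom φ ≫ h, fun _ _ => MetCategory.edist_comp_le_right _ _ _⟩

theorem isMetFunctor_nerveObj (M : T.Mod) : IsMetFunctor (nerveObj M) :=
  fun _ _ φ ψ => iSup_le fun h =>
    MetCategory.edist_comp_le_left (TheoryObj.toHom φ) (TheoryObj.toHom ψ) h

theorem preservesCountablePowers_nerveObj (M : T.Mod) : PreservesCountablePowers (nerveObj M) :=
  .of_exists fun V _ _ X => ⟨_, _, TheoryObj.isPower_functor_tensorProj V X.space,
    isPower_met_iff.2 ⟨fun v w => (isMetFunctor_nerveObj M _ _ _ _).trans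
        ((TheoryObj.isPower_functor_tensorProj V X.space).nonexpansive v w),
      fun φ => exists_tensor_lift M φ.toFun φ.nonexpansive, fun p q => tensor_isometry p q⟩⟩

variable (T) in
/-- The functor that sends a model to its nerve. -/
noncomputable def nerve : T.Mod ⥤ T.lawvereTheory.Mod where
  obj M := ⟨nerveObj M, isMetFunctor_nerveObj M, preservesCountablePowers_nerveObj M⟩
  map g := ObjectProperty.homMk
    { app := fun _ => ⟨fun h => h ≫ g.hom, fun _ _ => MetCategory.edist_comp_le_left _ _ _⟩
      naturality := fun _ _ _ => rfl }

variable (T) in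
/-- The nerve commutes with the forgetful functors. -/
noncomputable def nerveForgetIso : T.nerve ⋙ T.lawvereTheory.forget ≅ T.forget :=
  NatIso.ofComponents (fun M =>
    { hom := ⟨fun φ => eval φ, edist_eval_le⟩
      inv := ⟨point M, edist_point_le M⟩
      hom_inv_id := NonexpMap.ext (funext (point_eval M))
      inv_hom_id := NonexpMap.ext (funext (eval_point M)) }) fun _ => rfl

instance : T.nerve.Faithful where
  map_injective {M N} f g h := ObjectProperty.hom_ext _ (SigModel.Hom.ext (NonexpMap.ext (funext
    fun m => by
      have h' := congrArg (fun θ => eval (M := N.obj) (NonexpMap.toFun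
        (NatTrans.app θ.hom (TheoryObj.gen T)) (point M m))) h
      change eval (point M m ≫ f.hom) = eval (point M m ≫ g.hom) at h'
      rwa [eval_comp, eval_comp, eval_point] at h')))

end MetricEquationalTheory

namespace MetricEquationalTheory

variable {Ω : MetricSignature.{u}} {T : MetricEquationalTheory Ω}

section Arities

/-- The arity of an operation, as an object of the theory. -/
noncomputable def arityObj (T : MetricEquationalTheory Ω) (f : Ω.Op) : TheoryObj T :=
  ⟨⟨⟨ULift.{u} (Ω.arity f)⟩, inferInstanceAs (Countable (ULift.{u} (Ω.arity f)))⟩⟩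

/-- A family indexed by an arity, as a map on the corresponding object. -/
def ofArity {f : Ω.Op} {Y : Type u} [EMetricSpace Y] (a : NonexpMap (Ω.arity f) Y) :
    NonexpMap (T.arityObj f).space.obj Y :=
  ⟨fun i => a (ULift.down i), fun i j => a.nonexpansive (ULift.down i) (ULift.down j)⟩

variable (T) in
/-- An operation applied to the generators of the free model on its arity. -/
noncomputable def genericOp (f : Ω.Op) : (T.arityObj f).freeMod.obj.space :=
  (T.arityObj f).freeMod.obj.op f ⟨fun i => T.unit (T.arityObj f).space.obj (ULift.up i),
    fun i j => (T.unit (T.arityObj f).space.obj).nonexpansive (ULift.up i) (ULift.up j)⟩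

theorem hom_genericOp (f : Ω.Op) {M : SigModel Ω} (φ : (T.arityObj f).freeMod.obj ⟶ M)
    (a : NonexpMap (Ω.arity f) M.space)
    (h : ∀ i, φ.map.toFun (T.unit (T.arityObj f).space.obj (ULift.up i)) = a i) :
    φ.map.toFun (T.genericOp f) = M.op f a :=
  (φ.map_op f _).trans (congrArg _ (NonexpMap.ext (funext h)))

theorem exists_arity_hom (f : Ω.Op) (M : T.Mod) (a : NonexpMap (Ω.arity f) M.obj.space) :
    ∃ φ : (T.arityObj f).freeMod.obj ⟶ M.obj,
      (∀ i, φ.map.toFun (T.unit (T.arityObj f).space.obj (ULift.up i)) = a i) ∧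
      φ.map.toFun (T.genericOp f) = M.obj.op f a :=
  have h i := T.liftHom_unit M (ofArity (T := T) a) (ULift.up i)
  ⟨T.liftHom M (ofArity (T := T) a), h, hom_genericOp f _ a h⟩

end Arities

/-! ### The nerve is full -/

section Full

variable {M N : T.Mod} (θ : nerveObj M ⟶ nerveObj N)

/-- Naturality on a homomorphism between free models. -/
theorem nerve_naturality {A B : TheoryObj T} (φ : B.freeMod.obj ⟶ A.freeMod.obj)
    (h : A.freeMod.obj ⟶ M.obj) :
    (θ.app B).toFun (φ ≫ h : B.freeMod.obj ⟶ M.obj) =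
      (φ ≫ ((θ.app A).toFun h : A.freeMod.obj ⟶ N.obj) : B.freeMod.obj ⟶ N.obj) :=
  congrArg (fun k : (nerveObj M).obj A ⟶ (nerveObj N).obj B => k.toFun h)
    (θ.naturality (TheoryObj.ofHom φ))

/-- The map of models underlying a transformation of nerves. -/
noncomputable def fullMap : M.obj.space ⟶ N.obj.space where
  toFun m := eval (M := N.obj) ((θ.app (TheoryObj.gen T)).toFun (point M m))
  nonexpansive m m' := (edist_eval_le _ _).trans (((θ.app _).nonexpansive _ _).trans
    (edist_point_le M m m'))

theorem app_apply {A : TheoryObj T} (h : A.freeMod.obj ⟶ M.obj) (p : A.freeMod.obj.space) :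
    (SigModel.Hom.map ((θ.app A).toFun h : A.freeMod.obj ⟶ N.obj)).toFun p =
      (fullMap θ).toFun (h.map.toFun p) := by
  have e := nerve_naturality θ (B := TheoryObj.gen T) (point A.freeMod p) h
  refine Eq.trans ?_ (congrArg (eval (M := N.obj)) (e.symm.trans
    (congrArg (θ.app (TheoryObj.gen T)).toFun (point_comp A.freeMod M p h))))
  exact congrArg (SigModel.Hom.map ((θ.app A).toFun h : A.freeMod.obj ⟶ N.obj)).toFun
    (eval_point A.freeMod p).symm

/-- The homomorphism of models underlying a transformation of nerves. -/
noncomputable def fullHom : M ⟶ N := ObjectProperty.homMk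
  { map := fullMap θ
    map_op := fun f a => by
      obtain ⟨φ, h₁, h₂⟩ := exists_arity_hom f M a
      rw [← h₂, ← app_apply θ φ]
      exact hom_genericOp f _ _ fun i => (app_apply θ φ _).trans (congrArg _ (h₁ i)) }

instance : T.nerve.Full where
  map_surjective θ := ⟨fullHom θ.hom, ObjectProperty.hom_ext _ (NatTrans.ext (funext
    fun _ => NonexpMap.ext (funext fun h => hom_ext fun _ => (app_apply θ.hom h _).symm)))⟩

end Full

/-! ### The nerve is essentially surjective -/

section EssSurj

/-- An object of the theory is a power of the generator. -/
theorem TheoryObj.exists_isPower (A : TheoryObj T) : ∃ (V : Type) (_ : EMetricSpace V)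
    (_ : Countable V) (e : V ≃ A.space.obj), (∀ v w, edist v w = edist (e v) (e w)) ∧
      IsPower V (fun v => proj (e v) : V → (A ⟶ gen T)) := by
  have := A.space.property
  let e : Shrink.{0} A.space.obj ≃ A.space.obj := (equivShrink _).symm
  let _ : EMetricSpace (Shrink.{0} A.space.obj) := EMetricSpace.induced e e.injective inferInstance
  refine ⟨Shrink.{0} A.space.obj, inferInstance, e.injective.countable, e, fun _ _ => rfl,
    fun v w => (edist_elt_le _ _).trans ((T.unit _).nonexpansive _ _), fun B φ hφ => ?_,
    fun B g h => le_antisymm ?_ (iSup_le fun v => MetCategory.edist_comp_le_left _ _ _)⟩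
  · have key (g : B ⟶ A) : (∀ v, g ≫ proj (e v) = φ v) ↔
        ∀ x, (toHom g).map.toFun (T.unit _ x) = eval (toHom (φ (e.symm x))) := by
      rw [← e.forall_congr_right]
      refine forall_congr' fun v => ?_
      rw [comp_proj, e.symm_apply_apply]
      constructor
      · intro h
        rw [← h, eval_toHom_elt]
      · intro h
        rw [h]
        exact point_eval B.freeMod _
    have hn : Nonexpansive fun x => eval (toHom (φ (e.symm x))) := fun x y =>
      (edist_eval_le _ _).trans ((hφ _ _).trans (by
        change edist (e (e.symm x)) (e (e.symm y)) ≤ _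
        rw [e.apply_symm_apply, e.apply_symm_apply]))
    refine ⟨ofHom (T.liftHom B.freeMod ⟨_, hn⟩), (key _).2 fun x => T.liftHom_unit _ _ x,
      fun g hg => hom_ext fun x => ((key g).1 hg x).trans
        (T.liftHom_unit B.freeMod ⟨_, hn⟩ x).symm⟩
  · refine edist_le_of_unit fun x => le_iSup_of_le (e.symm x) ?_
    rw [e.apply_symm_apply, comp_proj, comp_proj]
    refine le_trans ?_ (edist_eval_le _ _)
    exact (congrArg₂ edist (eval_toHom_elt _) (eval_toHom_elt _)).ge

variable {N : TheoryObj T ⥤ Met.{u}} (hN : IsMetFunctor N) (hP : PreservesCountablePowers N)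

include hP in
theorem edist_eq_iSup_proj {A : TheoryObj T} (a b : N.obj A) : edist a b =
    ⨆ x : A.space.obj, edist ((N.map (TheoryObj.proj x)).toFun a)
      ((N.map (TheoryObj.proj x)).toFun b) := by
  obtain ⟨V, _, _, e, -, h⟩ := A.exists_isPower
  exact ((isPower_met_iff.1 (hP V _ _ _ h)).2.2 a b).trans (e.iSup_congr fun _ => rfl)

include hP in
theorem ext_proj {A : TheoryObj T} {a b : N.obj A}
    (h : ∀ x, (N.map (TheoryObj.proj x)).toFun a = (N.map (TheoryObj.proj x)).toFun b) : a = b := by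
  refine edist_le_zero.1 ((edist_eq_iSup_proj hP a b).trans_le (iSup_le fun x => ?_))
  rw [h x, edist_self]

include hP in
theorem exists_tuple {A : TheoryObj T} (φ : NonexpMap A.space.obj (N.obj (TheoryObj.gen T))) :
    ∃ a : N.obj A, ∀ x, (N.map (TheoryObj.proj x)).toFun a = φ x := by
  obtain ⟨V, _, _, e, he, h⟩ := A.exists_isPower
  obtain ⟨a, ha⟩ := (isPower_met_iff.1 (hP V _ _ _ h)).2.1
    ⟨fun v => φ (e v), fun v w => (φ.nonexpansive _ _).trans (he v w).ge⟩
  exact ⟨a, fun x => by simpa using ha (e.symm x)⟩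

/-- The element with given components. -/
noncomputable def tuple {A : TheoryObj T} (φ : NonexpMap A.space.obj (N.obj (TheoryObj.gen T))) :
    N.obj A := (exists_tuple hP φ).choose

theorem proj_tuple {A : TheoryObj T} (φ : NonexpMap A.space.obj (N.obj (TheoryObj.gen T)))
    (x : A.space.obj) : (N.map (TheoryObj.proj x)).toFun (tuple hP φ) = φ x :=
  (exists_tuple hP φ).choose_spec x

/-- The structure on the value at the generator of a model of the Lawvere theory. -/
noncomputable def structureOf : SigModel Ω where
  space := N.obj (TheoryObj.gen T)
  op f :=
    { toFun := fun a => (N.map (TheoryObj.elt (T.genericOp f))).toFun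
        (tuple hP (ofArity a : NonexpMap (T.arityObj f).space.obj _))
      nonexpansive := fun a b => by
        refine ((N.map _).nonexpansive _ _).trans ((edist_eq_iSup_proj hP _ _).trans_le
          (iSup_le fun i => ?_))
        rw [proj_tuple, proj_tuple]
        exact NonexpMap.edist_apply_le a b (ULift.down i) }

theorem map_comp_elt {A B : TheoryObj T} (φ : A ⟶ B) (p : B.freeMod.obj.space) (a : N.obj A) :
    (N.map (TheoryObj.elt p)).toFun ((N.map φ).toFun a) =
      (N.map (TheoryObj.elt ((TheoryObj.toHom φ).map.toFun p))).toFun a := by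
  rw [← TheoryObj.comp_elt, N.map_comp]
  rfl

include hN in
/-- An element of the value at an object defines a homomorphism on the free model. -/
noncomputable def evalAt {A : TheoryObj T} (a : N.obj A) : A.freeMod.obj ⟶ structureOf hP where
  map := ⟨fun p => (N.map (TheoryObj.elt p)).toFun a, fun p q =>
    (NonexpMap.edist_apply_le (N.map (TheoryObj.elt p)) (N.map (TheoryObj.elt q)) a).trans
      ((hN _ _ _ _).trans (TheoryObj.edist_elt_le p q))⟩
  map_op f b := by
    obtain ⟨φ, h₁, h₂⟩ := exists_arity_hom f A.freeMod b
    change (N.map (TheoryObj.elt (A.freeMod.obj.op f b))).toFun a = _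
    rw [← h₂]
    refine (map_comp_elt (TheoryObj.ofHom φ) (T.genericOp f) a).symm.trans (congrArg _ ?_)
    refine ext_proj hP fun i => ?_
    rw [proj_tuple]
    refine (map_comp_elt (TheoryObj.ofHom φ) _ a).trans ?_
    exact congrArg (fun p : A.freeMod.obj.space => (N.map (TheoryObj.elt p)).toFun a) (h₁ i.down)

/-- The structure on the value at the generator is a model. -/
noncomputable def modelOf : T.Mod where
  obj := structureOf hP
  property j hj := SigModel.satisfies_of_lift_assign j fun Γ α => by
    let A : TheoryObj T := ⟨⟨⟨Set.range α.1⟩, (Set.countable_range α.1).to_subtype⟩⟩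
    let a : N.obj A := tuple hP ⟨Subtype.val, fun _ _ => le_rfl⟩
    exact ⟨A.freeMod.obj, evalAt hN hP a, ⟨fun n => T.unit A.space.obj ⟨α.1 n, n, rfl⟩,
      fun e he => ((T.unit A.space.obj).nonexpansive _ _).trans (α.2 e he)⟩,
      A.freeMod.property j hj, Subtype.ext (funext fun n => proj_tuple hP _ _)⟩

/-- Every model of the Lawvere theory is the nerve of a model. -/
noncomputable def nerveModelOfIso : N ≅ nerveObj (modelOf hN hP) :=
  NatIso.ofComponents (fun A =>
    { hom := ⟨fun a => evalAt hN hP a, fun a b => edist_le_of_unit fun x =>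
        (N.map (TheoryObj.proj x)).nonexpansive a b⟩
      inv := ⟨fun h => tuple hP (NonexpMap.comp (SigModel.Hom.map h) (T.unit A.space.obj)),
        fun h k => (edist_eq_iSup_proj hP _ _).trans_le (iSup_le fun x => by
          rw [proj_tuple, proj_tuple]
          exact SigModel.edist_hom_apply_le h k _)⟩
      hom_inv_id := NonexpMap.ext (funext fun a => ext_proj hP fun x => proj_tuple hP _ x)
      inv_hom_id := NonexpMap.ext (funext fun h => hom_ext fun x => proj_tuple hP _ x) })
    fun φ => NonexpMap.ext (funext fun a => SigModel.Hom.ext (NonexpMap.ext (funext fun p =>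
      map_comp_elt φ p a)))

instance : T.nerve.EssSurj where
  mem_essImage N := ⟨modelOf N.property.1 N.property.2,
    ⟨ObjectProperty.isoMk _ (nerveModelOfIso N.property.1 N.property.2).symm⟩⟩

instance : T.nerve.IsEquivalence where

end EssSurj

end MetricEquationalTheory

theorem mainTheorem5 {Ω : MetricSignature.{u}} (T : MetricEquationalTheory Ω) :
    (T.forget.IsRightAdjoint ∧
      ∀ (Free : Met.{u} ⥤ T.Mod) (adj : Free ⊣ T.forget),
        adj.toMonad.toFunctor.IsCardinalAccessible (ℵ₁ : Cardinal.{u})) ∧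
    ∃ (L : MetLawvereTheory.{u}) (e : T.Mod ≌ L.Mod),
      Nonempty (e.functor ⋙ L.forget ≅ T.forget) := by
  exact ⟨⟨T.isRightAdjoint_forget, MetricEquationalTheory.isCardinalAccessible_monad⟩,
    T.lawvereTheory, T.nerve.asEquivalence, ⟨T.nerveForgetIso⟩⟩
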